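/- Let $w\in(0,1)$ and $\Delta\in(0,1]$. For a probability measure $\mu$ on $[0,1]$ and a bounded measurable $h:[0,1]\to\mathbb{R}$ put $$\mathcal A(\mu)h(x)=2\int_{[0,1]}\big[h(wx+(1-w)y)-h(x)\big]\mathbf 1_{\{|x-y|\le\Delta\}}\,\mu(dy),\qquad x\in[0,1].$$ A family $m=(m(t),t\in\mathbb{R}_+)$ of probability measures on $[0,1]$ is a solution to Problem 1 with initial value $m_0\in\mathcal P[0,1]$ if $m(0)=m_0$ and, for all $t\ge 0$ and all bounded measurable $h:[0,1]\to\mathbb{R}$, the function $s\mapsto\langle\mathcal A(m(s))h,m(s)\rangle$ is integrable on $[0,t]$ and $$\langle h,m(t)\rangle-\langle h,m(0)\rangle=\int_0^t\langle \mathcal A(m(s))h,m(s)\rangle\,ds .$$ Let $|\mu-\nu|=\sup\{\langle\phi,\mu\rangle-\langle\phi,\nu\rangle:\phi\text{ measurable},\ \|\phi\|_\infty\le1\}$ be the total variation distance. Let $D(\mathbb{R}_+,[0,1])$ be the space of right-continuous paths with left-hand limits from $\mathbb{R}_+$ to $[0,1]$, with the product $\sigma$-field and the canonical process $X=(X_t)_{t\ge0}$.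 A probability measure $Q$ on $D(\mathbb{R}_+,[0,1])$ is called the law of an inhomogeneous Markov process with generator $\mathcal A(m(t))$ at time $t$ and initial law $m_0$ if, under $Q$, $X_0$ has law $m_0$, $X$ has the Markov property with respect to its natural filtration, and for every bounded measurable $h$ the process $h(X_t)-h(X_0)-\int_0^t\mathcal A(m(s))h(X_s)\,ds$ is a martingale for that filtration. **Theorem.** 1. For every $m_0\in\mathcal P[0,1]$ there is a unique solution $m=(m(t),t\in\mathbb{R}_+)$ to Problem 1 with initial value $m_0$. The map $t\mapsto m(t)$ is continuous for the total variation distance. The map $m_0\mapsto(m(t),t\in\mathbb{R}_+)$ is continuous, for the total variation distance on the initial values and uniform convergence in total variation on bounded time sets for the solutions: for all $m_0$, $T\ge0$ and $\varepsilon>0$ there is $\delta>0$ such that, if $|m_0'-m_0|<\delta$ and $m'$ is the solution with initial value $m_0'$, then $|m'(t)-m(t)|<\varepsilon$ for all $t\in[0,T]$. 2. For every $m_0\in\mathcal P[0,1]$, with $m$ the solution to Problem 1 with initial value $m_0$, there is a unique law $Q$ on $D(\mathbb{R}_+,[0,1])$ of an inhomogeneous Markov process with generator $\mathcal A(m(t))$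 at time $t$ and initial law $m_0$. Its marginal at each time $t\ge 0$ is $Q_t=m(t)$. -/

import Mathlib

open MeasureTheory ProbabilityTheory Filter Topology
open scoped NNReal

noncomputable section

namespace Deffuant

/-- The space of opinions `[0,1]`, with its usual topology and Borel σ-field. -/
abbrev Opinion : Type := unitInterval

/-- `w x + (1 - w) y`, the new opinion of a peer with opinion `x` after meeting opinion `y`. -/
def mix (w x y : Opinion) : Opinion :=
  ⟨w * x + (1 - w) * y, by
    have hw0 := w.2.1
    have hw1 := w.2.2
    refine ⟨add_nonneg (mul_nonneg hw0 x.2.1) (mul_nonneg (by linarith) y.2.1), ?_⟩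
    nlinarith [mul_le_mul_of_nonneg_left x.2.2 hw0,
      mul_le_mul_of_nonneg_left y.2.2 (sub_nonneg.2 hw1)]⟩

/-- Bounded measurable real functions on a measurable space. -/
def IsBoundedMeasurable {S : Type*} [MeasurableSpace S] (h : S → ℝ) : Prop :=
  Measurable h ∧ ∃ C : ℝ, ∀ x, |h x| ≤ C

/-- The generator
`𝒜(μ) h (x) = 2 ∫ [h (w x + (1 - w) y) - h x] 1_{|x - y| ≤ Δ} μ(dy)`. -/
def generator (w : Opinion) (Δ : ℝ) (μ : ProbabilityMeasure Opinion)
    (h : Opinion → ℝ) (x : Opinion) : ℝ :=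
  2 * ∫ y, Set.indicator {y : Opinion | |(x : ℝ) - (y : ℝ)| ≤ Δ}
    (fun y => h (mix w x y) - h x) y ∂(μ : Measure Opinion)

/-- `m` solves Problem 1 with initial value `m₀`: the initial value is `m₀`, and
`⟨h, m(t)⟩ - ⟨h, m(0)⟩ = ∫₀ᵗ ⟨𝒜(m(s)) h, m(s)⟩ ds` for all `t ≥ 0` and all bounded measurable `h`,
the time integral being that of a Lebesgue integrable function. -/
def IsSolution (w : Opinion) (Δ : ℝ) (m₀ : ProbabilityMeasure Opinion)
    (m : ℝ≥0 → ProbabilityMeasure Opinion) : Prop :=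
  m 0 = m₀ ∧
  ∀ h : Opinion → ℝ, IsBoundedMeasurable h → ∀ t : ℝ≥0,
    IntervalIntegrable
      (fun s : ℝ => ∫ x, generator w Δ (m s.toNNReal) h x ∂(m s.toNNReal : Measure Opinion))
      volume 0 t ∧
    (∫ x, h x ∂(m t : Measure Opinion)) - ∫ x, h x ∂(m 0 : Measure Opinion) =
      ∫ s in (0 : ℝ)..t,
        ∫ x, generator w Δ (m s.toNNReal) h x ∂(m s.toNNReal : Measure Opinion)

/-- The total variation distance
`|μ - ν| = sup {⟨φ, μ⟩ - ⟨φ, ν⟩ : φ measurable, ‖φ‖_∞ ≤ 1}` (a supremum of a nonempty set of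
reals that is bounded above by `2`). -/
def tvDist {S : Type*} [MeasurableSpace S] (μ ν : ProbabilityMeasure S) : ℝ :=
  sSup {r : ℝ | ∃ φ : S → ℝ, Measurable φ ∧ (∀ x, |φ x| ≤ 1) ∧
    r = (∫ x, φ x ∂(μ : Measure S)) - ∫ x, φ x ∂(ν : Measure S)}

/-- Right-continuous paths with left-hand limits. -/
def IsCadlag {S : Type*} [TopologicalSpace S] (x : ℝ≥0 → S) : Prop :=
  ∀ t : ℝ≥0, ContinuousWithinAt x (Set.Ici t) t ∧ ∃ l : S, Tendsto x (𝓝[<] t) (𝓝 l)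

/-- The space `D(ℝ₊, S)`; its σ-field is the trace of the product σ-field. -/
abbrev SkorokhodSpace (S : Type*) [TopologicalSpace S] : Type _ :=
  {x : ℝ≥0 → S // IsCadlag x}

/-- The coordinate `X_t` of the canonical process on `D(ℝ₊, [0,1])`. -/
def coord (t : ℝ≥0) (x : SkorokhodSpace Opinion) : Opinion := x.1 t

theorem measurable_coord (t : ℝ≥0) : Measurable (coord t) :=
  (measurable_pi_apply t).comp measurable_subtype_coe

/-- The natural filtration `σ(X_u, u ≤ t)` of the canonical process. -/
def canonicalFiltration :
    Filtration ℝ≥0 (inferInstance : MeasurableSpace (SkorokhodSpace Opinion)) :=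
  Filtration.natural coord fun t => (measurable_coord t).stronglyMeasurable

/-- `Q` is the law on `D(ℝ₊, [0,1])` of an inhomogeneous Markov process with initial law `m₀` and
generator `A t` at time `t`: under `Q` the canonical process `X` starts from `m₀`, has the Markov
property with respect to its natural filtration, and
`h(X_t) - h(X_0) - ∫₀ᵗ (A s h)(X_s) ds` is a martingale for every bounded measurable `h`. -/
structure IsMarkovLaw (A : ℝ≥0 → (Opinion → ℝ) → Opinion → ℝ)
    (m₀ : ProbabilityMeasure Opinion)
    (Q : ProbabilityMeasure (SkorokhodSpace Opinion)) : Prop where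
  initial : (Q : Measure (SkorokhodSpace Opinion)).map (coord 0) = (m₀ : Measure Opinion)
  markov : ∀ h : Opinion → ℝ, IsBoundedMeasurable h → ∀ s t : ℝ≥0, s ≤ t →
    (Q : Measure (SkorokhodSpace Opinion))[fun x => h (coord t x) | canonicalFiltration s]
      =ᵐ[(Q : Measure (SkorokhodSpace Opinion))]
    (Q : Measure (SkorokhodSpace Opinion))[fun x => h (coord t x) |
      MeasurableSpace.comap (coord s) inferInstance]
  generator : ∀ h : Opinion → ℝ, IsBoundedMeasurable h →
    Martingale
      (fun (t : ℝ≥0) (x : SkorokhodSpace Opinion) =>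
        h (coord t x) - h (coord 0 x)
          - ∫ s in (0 : ℝ)..t, A s.toNNReal h (coord s.toNNReal x))
      canonicalFiltration (Q : Measure (SkorokhodSpace Opinion))

end Deffuant

end

/-!
A collision of a particle of law `μ` with an independent one of law `ν` produces a particle whose
law is bilinear in `(μ, ν)`. Testing against bounded measurable functions, the difference of two
solutions is therefore a functional which is the integral over time of itself applied to functions
of comparable size; Grönwall's inequality then bounds it by its initial value, which gives
uniqueness and the continuous dependence on the initial value. Existence comes from the Wild sum:
the law at time `t` mixes, with geometric weights of parameter `1 - exp (-r t)`, the laws at the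
root of random collision trees with leaves of law `m₀`.

For a solution of the martingale problem and `ξ` a bounded variable known at time `s`, the
functional `h ↦ E[ξ h(X_t)]`, `t ≥ s`, solves a linear equation with bounded generator, so it is
determined by its value at time `s`, by Grönwall again. Applied to `ξ - E[ξ | X_s]` this gives the
Markov property; iterated over products of functions of the path at successive times it gives the
uniqueness of the law; and for `ξ = 1` it identifies the marginals, since `m` solves the same
equation.

To construct the process, let a particle wait independent exponential times of rate `r` and meet at
each jump time `t` a partner of law `m(t)`, drawn as a measurable function of `t` and an independent
uniform mark. On each interval between jumps, `h` of the jump minus its compensator has mean zero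
conditionally on the past, because exponential waiting times are memoryless; summing over the jumps
gives the martingale property.
-/

noncomputable section

namespace Deffuant

section BoundedFunctions

variable {S T : Type*} [MeasurableSpace S] [MeasurableSpace T]

/-- Measurable real functions bounded in absolute value by a given constant: the quantitative form
of `IsBoundedMeasurable`. -/
structure BoundedBy (h : S → ℝ) (C : ℝ) : Prop where
  measurable : Measurable h
  abs_le : ∀ x, |h x| ≤ C

theorem isBoundedMeasurable_iff {h : S → ℝ} : IsBoundedMeasurable h ↔ ∃ C, BoundedBy h C :=
  ⟨fun ⟨hm, C, hC⟩ => ⟨C, hm, hC⟩, fun ⟨C, hh⟩ => ⟨hh.measurable, C, hh.abs_le⟩⟩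

namespace BoundedBy

variable {h k : S → ℝ} {C D : ℝ}

theorem isBoundedMeasurable (hh : BoundedBy h C) : IsBoundedMeasurable h :=
  isBoundedMeasurable_iff.2 ⟨C, hh⟩

theorem nonneg [Nonempty S] (hh : BoundedBy h C) : 0 ≤ C :=
  (abs_nonneg _).trans (hh.abs_le (Classical.arbitrary S))

theorem comp (hh : BoundedBy h C) {f : T → S} (hf : Measurable f) : BoundedBy (h ∘ f) C :=
  ⟨hh.measurable.comp hf, fun _ => hh.abs_le _⟩

theorem const_mul (hh : BoundedBy h C) {a : ℝ} (ha : 0 ≤ a) :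
    BoundedBy (fun x => a * h x) (a * C) :=
  ⟨hh.measurable.const_mul a, fun x => by
    rw [abs_mul, abs_of_nonneg ha]
    exact mul_le_mul_of_nonneg_left (hh.abs_le x) ha⟩

theorem add (hh : BoundedBy h C) (hk : BoundedBy k D) : BoundedBy (fun x => h x + k x) (C + D) :=
  ⟨hh.measurable.add hk.measurable, fun x =>
    (abs_add_le _ _).trans (add_le_add (hh.abs_le x) (hk.abs_le x))⟩

theorem sub (hh : BoundedBy h C) (hk : BoundedBy k D) : BoundedBy (fun x => h x - k x) (C + D) :=
  ⟨hh.measurable.sub hk.measurable, fun x =>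
    (abs_sub _ _).trans (add_le_add (hh.abs_le x) (hk.abs_le x))⟩

theorem mul (hh : BoundedBy h C) (hk : BoundedBy k D) : BoundedBy (fun x => h x * k x) (C * D) :=
  ⟨hh.measurable.mul hk.measurable, fun x => by
    rw [abs_mul]
    exact mul_le_mul (hh.abs_le x) (hk.abs_le x) (abs_nonneg _)
      ((abs_nonneg _).trans (hh.abs_le x))⟩

theorem integrable (hh : BoundedBy h C) (μ : Measure S) [IsFiniteMeasure μ] : Integrable h μ :=
  Integrable.of_bound hh.measurable.aestronglyMeasurable C (Eventually.of_forall hh.abs_le)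

theorem abs_integral_le (hh : BoundedBy h C) (μ : Measure S) [IsProbabilityMeasure μ] :
    |∫ x, h x ∂μ| ≤ C := by
  simpa using norm_integral_le_of_norm_le_const (f := h) (μ := μ) (Eventually.of_forall hh.abs_le)

theorem abs_integral_sub_integral_le (hh : BoundedBy h C) (μ ν : Measure S)
    [IsProbabilityMeasure μ] [IsProbabilityMeasure ν] : |∫ x, h x ∂μ - ∫ x, h x ∂ν| ≤ 2 * C := by
  linarith [abs_sub (∫ x, h x ∂μ) (∫ x, h x ∂ν), hh.abs_integral_le μ, hh.abs_integral_le ν]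

theorem integral_prod_right {f : S × T → ℝ} (hf : BoundedBy f C) (ν : Measure T)
    [IsProbabilityMeasure ν] : BoundedBy (fun x => ∫ y, f (x, y) ∂ν) C :=
  ⟨hf.measurable.stronglyMeasurable.integral_prod_right'.measurable, fun _ =>
    (hf.comp measurable_prodMk_left).abs_integral_le ν⟩

theorem integral_prod_left {f : S × T → ℝ} (hf : BoundedBy f C) (μ : Measure S)
    [IsProbabilityMeasure μ] : BoundedBy (fun y => ∫ x, f (x, y) ∂μ) C :=
  ⟨hf.measurable.stronglyMeasurable.integral_prod_left'.measurable, fun _ =>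
    (hf.comp measurable_prodMk_right).abs_integral_le μ⟩

theorem indicator (hh : BoundedBy h C) {s : Set S} (hs : MeasurableSet s) :
    BoundedBy (s.indicator h) C :=
  ⟨hh.measurable.indicator hs, fun x => (norm_indicator_le_norm_self h x).trans (hh.abs_le x)⟩

end BoundedBy

theorem boundedBy_indicator_one {s : Set S} (hs : MeasurableSet s) :
    BoundedBy (s.indicator (1 : S → ℝ)) 1 :=
  BoundedBy.indicator ⟨measurable_one, fun _ => abs_one.le⟩ hs

theorem ext_of_integral_eq {μ ν : Measure S} [IsFiniteMeasure μ] [IsFiniteMeasure ν]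
    (hμν : ∀ h : S → ℝ, BoundedBy h 1 → ∫ x, h x ∂μ = ∫ x, h x ∂ν) : μ = ν := by
  refine Measure.ext fun s hs => (measureReal_eq_measureReal_iff).1 ?_
  simpa only [integral_indicator_one hs] using hμν _ (boundedBy_indicator_one hs)

end BoundedFunctions

section TotalVariation

variable {S : Type*} [MeasurableSpace S] (μ ν : ProbabilityMeasure S)

theorem integral_sub_integral_le_tvDist {φ : S → ℝ} (hφ : BoundedBy φ 1) :
    ∫ x, φ x ∂(μ : Measure S) - ∫ x, φ x ∂(ν : Measure S) ≤ tvDist μ ν := by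
  refine le_csSup ⟨2, ?_⟩ ⟨φ, hφ.measurable, hφ.abs_le, rfl⟩
  rintro _ ⟨ψ, hψ, hψ₁, rfl⟩
  simpa using (le_abs_self _).trans
    (BoundedBy.abs_integral_sub_integral_le ⟨hψ, hψ₁⟩ (μ : Measure S) ν)

theorem tvDist_nonneg : 0 ≤ tvDist μ ν := by
  simpa using integral_sub_integral_le_tvDist μ ν (φ := 0) ⟨measurable_const, by simp⟩

variable {μ ν}

theorem tvDist_le {c : ℝ} (hc : ∀ φ : S → ℝ, BoundedBy φ 1 →
      ∫ x, φ x ∂(μ : Measure S) - ∫ x, φ x ∂(ν : Measure S) ≤ c) : tvDist μ ν ≤ c := by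
  refine csSup_le ⟨_, 0, measurable_const, by simp, rfl⟩ ?_
  rintro _ ⟨φ, hφ, hφ₁, rfl⟩
  exact hc φ ⟨hφ, hφ₁⟩

theorem tvDist_self : tvDist μ μ = 0 :=
  le_antisymm (tvDist_le fun _ _ => (sub_self _).le) (tvDist_nonneg μ μ)

variable (μ ν) in
theorem abs_integral_sub_integral_le_tvDist {h : S → ℝ} {C : ℝ} (hh : BoundedBy h C) :
    |∫ x, h x ∂(μ : Measure S) - ∫ x, h x ∂(ν : Measure S)| ≤ tvDist μ ν * C := by
  have : Nonempty S := nonempty_of_isProbabilityMeasure (μ : Measure S)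
  obtain rfl | hC := hh.nonneg.eq_or_lt
  · simp [show h = 0 from funext fun x => abs_nonpos_iff.1 (hh.abs_le x)]
  have scaled_le (a : ℝ) (ha : |a| = 1) :
      a * (∫ x, h x ∂(μ : Measure S) - ∫ x, h x ∂(ν : Measure S)) ≤ tvDist μ ν * C := by
    have hφ : BoundedBy (fun x => a / C * h x) 1 := by
      refine ⟨hh.measurable.const_mul _, fun x => ?_⟩
      rw [abs_mul, abs_div, ha, abs_of_pos hC, one_div_mul_eq_div]
      exact (div_le_one hC).2 (hh.abs_le x)
    have := integral_sub_integral_le_tvDist μ ν hφ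
    rwa [integral_const_mul, integral_const_mul, ← mul_sub, div_mul_eq_mul_div,
      div_le_iff₀ hC] at this
  rw [abs_le]
  constructor <;> linarith [scaled_le 1 abs_one, scaled_le (-1) (by simp)]

end TotalVariation

section Gronwall

variable {S : Type*} [MeasurableSpace S]

theorem integral_const_mul_exp (l t : ℝ) :
    ∫ r in (0 : ℝ)..t, l * Real.exp (l * r) = Real.exp (l * t) - 1 := by
  rw [intervalIntegral.integral_const_mul, intervalIntegral.mul_integral_comp_mul_left,
    integral_exp, mul_zero, Real.exp_zero]

theorem integral_pow_div_factorial (l t : ℝ) (n : ℕ) :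
    ∫ r in (0 : ℝ)..t, l * ((l * r) ^ n / n.factorial) = (l * t) ^ (n + 1) / (n + 1).factorial := by
  rw [intervalIntegral.integral_const_mul,
    intervalIntegral.mul_integral_comp_mul_left (f := fun r => r ^ n / n.factorial),
    intervalIntegral.integral_div, integral_pow, mul_zero, Nat.factorial_succ]
  push_cast
  field_simp
  simp

/-- The hypotheses of Grönwall's inequality for functionals `L t` on bounded measurable functions:
`L t` has norm at most `K`, and `L t h` is, up to an error `δ ‖h‖`, the integral over `[0, t]` of
`L r` applied to a function `g r` with `‖g r‖ ≤ l ‖h‖`. -/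
structure IsGronwallFamily (L : ℝ≥0 → (S → ℝ) → ℝ) (K l δ : ℝ) : Prop where
  abs_le : ∀ t h C, BoundedBy h C → |L t h| ≤ K * C
  exists_integral : ∀ h C, BoundedBy h C → ∃ g : ℝ≥0 → S → ℝ, (∀ r, BoundedBy (g r) (l * C)) ∧
    ∀ t : ℝ≥0, |L t h - ∫ r in (0 : ℝ)..t, L r.toNNReal (g r.toNNReal)| ≤ δ * C

namespace IsGronwallFamily

variable [Nonempty S] {L : ℝ≥0 → (S → ℝ) → ℝ} {K l δ C : ℝ} {h : S → ℝ}

theorem abs_le_iterate (hL : IsGronwallFamily L K l δ) (hδ : 0 ≤ δ) (n : ℕ) (t : ℝ≥0)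
    (hh : BoundedBy h C) :
    |L t h| ≤ C * (δ * Real.exp (l * t) + K * ((l * t) ^ n / n.factorial)) := by
  induction n generalizing t h C with
  | zero =>
    have : 0 ≤ C * (δ * Real.exp (l * t)) := mul_nonneg hh.nonneg (by positivity)
    have := hL.abs_le t h C hh
    simp only [pow_zero, Nat.factorial_zero, Nat.cast_one, div_one]
    linarith
  | succ n ih =>
    obtain ⟨g, hg, hgt⟩ := hL.exists_integral h C hh
    have integral_le : |∫ r in (0 : ℝ)..t, L r.toNNReal (g r.toNNReal)| ≤
        ∫ r in (0 : ℝ)..t, (C * δ * (l * Real.exp (l * r))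
          + C * K * (l * ((l * r) ^ n / n.factorial))) := by
      rw [← Real.norm_eq_abs]
      refine intervalIntegral.norm_integral_le_of_norm_le t.2 (Eventually.of_forall fun r hr => ?_)
        (Continuous.intervalIntegrable (by fun_prop) _ _)
      rw [Real.norm_eq_abs]
      refine (ih r.toNNReal (hg r.toNNReal)).trans_eq ?_
      rw [Real.coe_toNNReal r hr.1.le]
      ring
    rw [intervalIntegral.integral_add (Continuous.intervalIntegrable (by fun_prop) _ _)
      (Continuous.intervalIntegrable (by fun_prop) _ _),
      intervalIntegral.integral_const_mul (C * δ), intervalIntegral.integral_const_mul (C * K),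
      integral_pow_div_factorial, integral_const_mul_exp] at integral_le
    have := abs_sub_abs_le_abs_sub (L t h) (∫ r in (0 : ℝ)..t, L r.toNNReal (g r.toNNReal))
    linarith [hgt t]

theorem abs_le_exp (hL : IsGronwallFamily L K l δ) (hδ : 0 ≤ δ) (t : ℝ≥0) (hh : BoundedBy h C) :
    |L t h| ≤ δ * C * Real.exp (l * t) := by
  have hlim : Tendsto (fun n : ℕ => C * (δ * Real.exp (l * t) + K * ((l * t) ^ n / n.factorial)))
      atTop (𝓝 (C * (δ * Real.exp (l * t) + K * 0))) :=
    (((FloorSemiring.tendsto_pow_div_factorial_atTop (l * t)).const_mul K).const_add _).const_mul C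
  linarith [ge_of_tendsto' hlim fun n => hL.abs_le_iterate hδ n t hh]

end IsGronwallFamily

end Gronwall

section KineticEquation

variable {S : Type*} [MeasurableSpace S]

/-- A measurable rule giving the state of a particle in state `x` after it has met a particle in
state `y`. -/
structure CollisionRule (S : Type*) [MeasurableSpace S] where
  collide : S → S → S
  measurable_collide : Measurable fun p : S × S => collide p.1 p.2

namespace CollisionRule

variable (c : CollisionRule S) (r : ℝ≥0)

/-- The law of the state of a particle with law `μ` after it has met an independent particle with
law `ν`. -/
def collision (μ ν : Measure S) : Measure S :=
  (μ.prod ν).map fun p => c.collide p.1 p.2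

/-- The generator of a particle that meets particles with law `μ` at rate `r`. -/
def generator (μ : ProbabilityMeasure S) (h : S → ℝ) (x : S) : ℝ :=
  r * ∫ y, (h (c.collide x y) - h x) ∂(μ : Measure S)

/-- `m` solves the weak kinetic equation `d/dt ⟨h, m(t)⟩ = ⟨𝒜(m(t)) h, m(t)⟩`, in its integrated
form, with initial value `m₀`, where `𝒜` is the generator of `c` at rate `r`. -/
def IsSolution (m₀ : ProbabilityMeasure S) (m : ℝ≥0 → ProbabilityMeasure S) : Prop :=
  m 0 = m₀ ∧
  ∀ h : S → ℝ, IsBoundedMeasurable h → ∀ t : ℝ≥0,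
    IntervalIntegrable
      (fun s : ℝ => ∫ x, c.generator r (m s.toNNReal) h x ∂(m s.toNNReal : Measure S))
      volume 0 t ∧
    (∫ x, h x ∂(m t : Measure S)) - ∫ x, h x ∂(m 0 : Measure S) =
      ∫ s in (0 : ℝ)..t, ∫ x, c.generator r (m s.toNNReal) h x ∂(m s.toNNReal : Measure S)

instance (μ ν : Measure S) [IsProbabilityMeasure μ] [IsProbabilityMeasure ν] :
    IsProbabilityMeasure (c.collision μ ν) :=
  Measure.isProbabilityMeasure_map c.measurable_collide.aemeasurable

variable {h : S → ℝ} {C : ℝ}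

theorem boundedBy_comp_collide (hh : BoundedBy h C) :
    BoundedBy (fun p : S × S => h (c.collide p.1 p.2)) C :=
  hh.comp c.measurable_collide

variable {c r}

theorem integral_collision (hh : BoundedBy h C) (μ ν : Measure S) [IsProbabilityMeasure μ]
    [IsProbabilityMeasure ν] :
    ∫ x, h x ∂(c.collision μ ν) = ∫ x, ∫ y, h (c.collide x y) ∂ν ∂μ := by
  rw [collision, integral_map c.measurable_collide.aemeasurable
    hh.measurable.aestronglyMeasurable,
    integral_prod _ ((c.boundedBy_comp_collide hh).integrable _)]

theorem integral_collision_symm (hh : BoundedBy h C) (μ ν : Measure S) [IsProbabilityMeasure μ]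
    [IsProbabilityMeasure ν] :
    ∫ x, h x ∂(c.collision μ ν) = ∫ y, ∫ x, h (c.collide x y) ∂μ ∂ν := by
  rw [collision, integral_map c.measurable_collide.aemeasurable
    hh.measurable.aestronglyMeasurable,
    integral_prod_symm _ ((c.boundedBy_comp_collide hh).integrable _)]

theorem generator_eq (hh : BoundedBy h C) (μ : ProbabilityMeasure S) (x : S) :
    c.generator r μ h x = r * (∫ y, h (c.collide x y) ∂(μ : Measure S) - h x) := by
  have hint : Integrable (fun y => h (c.collide x y)) (μ : Measure S) :=
    ((c.boundedBy_comp_collide hh).comp measurable_prodMk_left).integrable _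
  simp [generator, integral_sub hint]

variable (c r) in
theorem boundedBy_generator (μ : ProbabilityMeasure S) (hh : BoundedBy h C) :
    BoundedBy (c.generator r μ h) (2 * r * C) := by
  rw [funext (generator_eq hh μ), show 2 * r * C = r * (C + C) by ring]
  exact (((c.boundedBy_comp_collide hh).integral_prod_right (μ : Measure S)).sub hh).const_mul r.2

theorem integral_generator (hh : BoundedBy h C) (μ ν : ProbabilityMeasure S) :
    ∫ x, c.generator r μ h x ∂(ν : Measure S) =
      r * (∫ x, h x ∂(c.collision ν μ) - ∫ x, h x ∂(ν : Measure S)) := by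
  simp only [generator_eq hh]
  rw [integral_const_mul, integral_sub
    (((c.boundedBy_comp_collide hh).integral_prod_right (μ : Measure S)).integrable _)
    (hh.integrable _), integral_collision hh]

variable (c r) in
/-- The generator of the signed measure `μ - ν` for solutions `μ`, `ν` of the kinetic equation: the
first particle of a colliding pair contributes `𝒜(μ)`, the second one an average over `ν`. -/
def pairGenerator (μ ν : ProbabilityMeasure S) (h : S → ℝ) (x : S) : ℝ :=
  c.generator r μ h x + r * ∫ y, h (c.collide y x) ∂(ν : Measure S)

variable (c r) in
theorem boundedBy_pairGenerator (μ ν : ProbabilityMeasure S) (hh : BoundedBy h C) :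
    BoundedBy (c.pairGenerator r μ ν h) (3 * r * C) := by
  rw [show 3 * r * C = 2 * r * C + r * C by ring]
  exact (c.boundedBy_generator r μ hh).add
    (((c.boundedBy_comp_collide hh).integral_prod_left (ν : Measure S)).const_mul r.2)

theorem integral_pairGenerator_sub (hh : BoundedBy h C) (μ ν : ProbabilityMeasure S) :
    ∫ x, c.pairGenerator r μ ν h x ∂(μ : Measure S)
        - ∫ x, c.pairGenerator r μ ν h x ∂(ν : Measure S) =
      ∫ x, c.generator r μ h x ∂(μ : Measure S) - ∫ x, c.generator r ν h x ∂(ν : Measure S) := by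
  have integral_pair (ρ : ProbabilityMeasure S) :
      ∫ x, c.pairGenerator r μ ν h x ∂(ρ : Measure S) =
        ∫ x, c.generator r μ h x ∂(ρ : Measure S) + r * ∫ x, h x ∂(c.collision ν ρ) := by
    rw [integral_collision_symm hh, ← integral_const_mul]
    exact integral_add ((c.boundedBy_generator r μ hh).integrable _)
      (((c.boundedBy_comp_collide hh).integral_prod_left (ν : Measure S)).integrable _
        |>.const_mul _)
  simp only [integral_pair, integral_generator hh]
  ring

namespace IsSolution

variable {m₀ m₀' : ProbabilityMeasure S} {m m' : ℝ≥0 → ProbabilityMeasure S}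

theorem abs_integral_sub_le (hm : c.IsSolution r m₀ m) (hh : BoundedBy h C) (s t : ℝ≥0) :
    |∫ x, h x ∂(m s : Measure S) - ∫ x, h x ∂(m t : Measure S)| ≤ 2 * r * C * |(s : ℝ) - t| := by
  have hmh := hm.2 h hh.isBoundedMeasurable
  have increment : ∫ x, h x ∂(m s : Measure S) - ∫ x, h x ∂(m t : Measure S) =
      ∫ v in (t : ℝ)..s,
        ∫ x, c.generator r (m v.toNNReal) h x ∂(m v.toNNReal : Measure S) := by
    rw [← intervalIntegral.integral_interval_sub_left (hmh s).1 (hmh t).1, ← (hmh s).2,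
      ← (hmh t).2, sub_sub_sub_cancel_right]
  rw [increment, ← Real.norm_eq_abs]
  exact intervalIntegral.norm_integral_le_of_norm_le_const fun _ _ =>
    (c.boundedBy_generator r _ hh).abs_integral_le _

theorem tendsto_tvDist (hm : c.IsSolution r m₀ m) (t : ℝ≥0) :
    Tendsto (fun s => tvDist (m s) (m t)) (𝓝 t) (𝓝 0) := by
  have lipschitz (s : ℝ≥0) : tvDist (m s) (m t) ≤ 2 * r * |(s : ℝ) - t| :=
    tvDist_le fun φ hφ => by simpa using (le_abs_self _).trans (hm.abs_integral_sub_le hφ s t)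
  refine squeeze_zero (fun s => tvDist_nonneg _ _) lipschitz ?_
  have : Continuous fun s : ℝ≥0 => 2 * r * |(s : ℝ) - t| := by fun_prop
  simpa using this.tendsto t

theorem isGronwallFamily (hm : c.IsSolution r m₀ m) (hm' : c.IsSolution r m₀' m') :
    IsGronwallFamily
      (fun t h => ∫ x, h x ∂(m t : Measure S) - ∫ x, h x ∂(m' t : Measure S))
      2 (3 * r) (tvDist m₀ m₀') where
  abs_le t h C hh := hh.abs_integral_sub_integral_le _ _
  exists_integral h C hh := by
    refine ⟨fun v => c.pairGenerator r (m v) (m' v) h, fun v => c.boundedBy_pairGenerator r _ _ hh,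
      fun t => ?_⟩
    obtain ⟨hint, hmt⟩ := hm.2 h hh.isBoundedMeasurable t
    obtain ⟨hint', hmt'⟩ := hm'.2 h hh.isBoundedMeasurable t
    simp only [integral_pairGenerator_sub hh]
    rw [intervalIntegral.integral_sub hint hint', ← hmt, ← hmt', hm.1, hm'.1]
    convert abs_integral_sub_integral_le_tvDist m₀ m₀' hh using 2
    ring

theorem abs_integral_sub_le_exp (hm : c.IsSolution r m₀ m) (hm' : c.IsSolution r m₀' m')
    (t : ℝ≥0) (hh : BoundedBy h C) :
    |∫ x, h x ∂(m t : Measure S) - ∫ x, h x ∂(m' t : Measure S)| ≤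
      tvDist m₀ m₀' * C * Real.exp (3 * r * t) :=
  have : Nonempty S := nonempty_of_isProbabilityMeasure (m₀ : Measure S)
  (hm.isGronwallFamily hm').abs_le_exp (tvDist_nonneg _ _) t hh

theorem unique (hm : c.IsSolution r m₀ m) (hm' : c.IsSolution r m₀ m') : m = m' := by
  refine funext fun t => ProbabilityMeasure.toMeasure_injective (ext_of_integral_eq fun h hh => ?_)
  have := hm.abs_integral_sub_le_exp hm' t hh
  rw [tvDist_self, zero_mul, zero_mul] at this
  exact sub_eq_zero.1 (abs_nonpos_iff.1 this)

theorem exists_tvDist_lt (hm : c.IsSolution r m₀ m) (T : ℝ≥0) {ε : ℝ} (hε : 0 < ε) :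
    ∃ δ : ℝ, 0 < δ ∧ ∀ (m₀' : ProbabilityMeasure S) (m' : ℝ≥0 → ProbabilityMeasure S),
      c.IsSolution r m₀' m' → tvDist m₀' m₀ < δ → ∀ t : ℝ≥0, t ≤ T → tvDist (m' t) (m t) < ε := by
  refine ⟨ε / Real.exp (3 * r * T), by positivity, fun m₀' m' hm' hδ t ht => ?_⟩
  calc tvDist (m' t) (m t) ≤ tvDist m₀' m₀ * Real.exp (3 * r * t) :=
        tvDist_le fun φ hφ => by
          simpa using (le_abs_self _).trans (hm'.abs_integral_sub_le_exp hm t hφ)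
    _ ≤ tvDist m₀' m₀ * Real.exp (3 * r * T) := by
        gcongr
        exact tvDist_nonneg _ _
    _ < ε := (lt_div_iff₀ (Real.exp_pos _)).1 hδ

end IsSolution

end CollisionRule

end KineticEquation

section PowerSeries

theorem hasDerivAt_tsum_pow_mul {q : ℕ → ℝ} {C : ℝ} (hq : ∀ n, |q n| ≤ C) {τ : ℝ} (hτ : |τ| < 1) :
    HasDerivAt (fun τ => ∑' n, τ ^ n * q n) (∑' n : ℕ, τ ^ n * ((n + 1) * q (n + 1))) τ := by
  obtain ⟨ρ, hτρ, hρ⟩ := exists_between hτ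
  have hρ₀ : 0 ≤ ρ := (abs_nonneg _).trans hτρ.le
  have : 0 ≤ C := (abs_nonneg _).trans (hq 0)
  have summable_bound : Summable fun n : ℕ => (n : ℝ) * ρ ^ (n - 1) * C := by
    refine Summable.mul_right C ((summable_nat_add_iff 1).1 ?_)
    refine ((summable_pow_mul_geometric_of_norm_lt_one 1
      (by rwa [Real.norm_of_nonneg hρ₀] : ‖ρ‖ < 1)).add
      (summable_geometric_of_lt_one hρ₀ hρ)).congr fun n => ?_
    rw [Nat.add_sub_cancel, Nat.cast_add_one, pow_one, add_one_mul]
  have deriv_le (n : ℕ) (y : ℝ) (hy : y ∈ Set.Ioo (-ρ) ρ) :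
      ‖(n : ℝ) * y ^ (n - 1) * q n‖ ≤ (n : ℝ) * ρ ^ (n - 1) * C := by
    have hyρ : |y| ≤ ρ := abs_le.2 ⟨hy.1.le, hy.2.le⟩
    rw [norm_mul, norm_mul, norm_pow, Real.norm_natCast, Real.norm_eq_abs, Real.norm_eq_abs]
    gcongr
    exact hq n
  have hmem : τ ∈ Set.Ioo (-ρ) ρ := abs_lt.1 hτρ
  have summable_at : Summable fun n => τ ^ n * q n := by
    refine Summable.of_norm_bounded
      ((summable_geometric_of_lt_one (abs_nonneg _) hτ).mul_right C) fun n => ?_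
    rw [norm_mul, norm_pow, Real.norm_eq_abs, Real.norm_eq_abs]
    gcongr
    exact hq n
  refine (hasDerivAt_tsum_of_isPreconnected summable_bound isOpen_Ioo isPreconnected_Ioo
    (fun n y _ => (hasDerivAt_pow n y).mul_const _) deriv_le hmem summable_at hmem).congr_deriv ?_
  rw [(Summable.of_norm_bounded summable_bound fun n => deriv_le n τ hmem).tsum_eq_zero_add]
  simp only [Nat.cast_zero, zero_mul, zero_add, Nat.add_sub_cancel, Nat.cast_add_one]
  exact tsum_congr fun n => by ring

theorem one_sub_exp_neg_mem_Ico (r t : ℝ≥0) : 1 - Real.exp (-(r * t : ℝ)) ∈ Set.Ico (0 : ℝ) 1 :=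
  ⟨sub_nonneg.2 (Real.exp_le_one_iff.2 (neg_nonpos.2 (by positivity))),
    sub_lt_self _ (Real.exp_pos _)⟩

theorem intervalIntegrable_of_hasDerivAt_of_abs_le {F f : ℝ → ℝ} {a b C : ℝ}
    (hF : ∀ s ∈ Set.uIcc a b, HasDerivAt F (f s) s) (hC : ∀ s, |f s| ≤ C) :
    IntervalIntegrable f volume a b := by
  rw [intervalIntegrable_iff]
  refine IntegrableOn.of_bound measure_Ioc_lt_top ?_ C (Eventually.of_forall hC)
  refine (measurable_deriv F).aestronglyMeasurable.congr ?_
  filter_upwards [ae_restrict_mem measurableSet_uIoc] with s hs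
  exact (hF s (Set.uIoc_subset_uIcc hs)).deriv

end PowerSeries

section WildSum

namespace CollisionRule

variable {S : Type*} [MeasurableSpace S] (c : CollisionRule S) (m₀ : ProbabilityMeasure S)

/-- The terms of the Wild sum: the law of the root of a random collision tree with `n` collisions
and leaves of law `m₀`, the split of the collisions between the two subtrees being uniform. -/
def wild : ℕ → Measure S
  | 0 => m₀
  | n + 1 => ((n : ENNReal) + 1)⁻¹ • ∑ k : Fin (n + 1), c.collision (wild k) (wild (n - k))
  decreasing_by all_goals omega

instance isProbabilityMeasure_wild (n : ℕ) : IsProbabilityMeasure (c.wild m₀ n) := by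
  induction n using Nat.strong_induction_on with
  | _ n ih =>
    cases n with
    | zero =>
      rw [wild]
      infer_instance
    | succ n =>
      have collision_univ (k : Fin (n + 1)) :
          c.collision (c.wild m₀ k) (c.wild m₀ (n - k)) Set.univ = 1 := by
        have := ih k (by omega)
        have := ih (n - k) (by omega)
        exact measure_univ
      constructor
      simp only [wild, Measure.smul_apply, Measure.finsetSum_apply, collision_univ,
        Finset.sum_const, Finset.card_univ, Fintype.card_fin, smul_eq_mul, nsmul_eq_mul, mul_one,
        Nat.cast_add_one]
      exact ENNReal.inv_mul_cancel (by simp) (by finiteness)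

variable {h : S → ℝ} {C : ℝ}

theorem integral_wild_succ (hh : BoundedBy h C) (n : ℕ) :
    ((n : ℝ) + 1) * ∫ x, h x ∂(c.wild m₀ (n + 1)) =
      ∑ p ∈ Finset.HasAntidiagonal.antidiagonal n,
        ∫ x, h x ∂(c.collision (c.wild m₀ p.1) (c.wild m₀ p.2)) := by
  rw [wild, integral_smul_measure, integral_finsetSum_measure fun i _ => hh.integrable _,
    Finset.Nat.sum_antidiagonal_eq_sum_range_succ_mk, Finset.sum_range, ENNReal.toReal_inv,
    ENNReal.toReal_add (by finiteness) (by finiteness), ENNReal.toReal_natCast,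
    ENNReal.toReal_one, smul_eq_mul, ← mul_assoc, mul_inv_cancel₀ (by positivity), one_mul]

/-- The mixture of the terms of the Wild sum with geometric weights of parameter `τ`. -/
def wildSum (τ : ℝ) : Measure S :=
  Measure.sum fun n => ENNReal.ofReal ((1 - τ) * τ ^ n) • c.wild m₀ n

variable {τ : ℝ}

theorem isProbabilityMeasure_wildSum (hτ : τ ∈ Set.Ico 0 1) :
    IsProbabilityMeasure (c.wildSum m₀ τ) := by
  have weights_sum : HasSum (fun n => (1 - τ) * τ ^ n) 1 := by
    simpa [mul_inv_cancel₀ (sub_pos.2 hτ.2).ne'] using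
      (hasSum_geometric_of_lt_one hτ.1 hτ.2).mul_left (1 - τ)
  constructor
  rw [wildSum, Measure.sum_apply _ MeasurableSet.univ]
  simp only [Measure.smul_apply, measure_univ, smul_eq_mul, mul_one]
  rw [← ENNReal.ofReal_tsum_of_nonneg (fun n => mul_nonneg (sub_pos.2 hτ.2).le (pow_nonneg hτ.1 n))
    weights_sum.summable, weights_sum.tsum_eq, ENNReal.ofReal_one]

theorem integral_wildSum (hτ : τ ∈ Set.Ico 0 1) (hh : BoundedBy h C) :
    ∫ x, h x ∂(c.wildSum m₀ τ) = (1 - τ) * ∑' n, τ ^ n * ∫ x, h x ∂(c.wild m₀ n) := by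
  have := c.isProbabilityMeasure_wildSum m₀ hτ
  have hasSum_terms := hasSum_integral_measure (hh.integrable (c.wildSum m₀ τ))
  rw [wildSum, ← hasSum_terms.tsum_eq, ← tsum_mul_left]
  refine tsum_congr fun n => ?_
  rw [integral_smul_measure, ENNReal.toReal_ofReal
    (mul_nonneg (sub_pos.2 hτ.2).le (pow_nonneg hτ.1 n)), smul_eq_mul, mul_assoc]

theorem collision_wildSum (hτ : τ ∈ Set.Ico 0 1) :
    c.collision (c.wildSum m₀ τ) (c.wildSum m₀ τ) =
      Measure.sum fun p : ℕ × ℕ => ENNReal.ofReal ((1 - τ) ^ 2 * τ ^ (p.1 + p.2)) •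
        c.collision (c.wild m₀ p.1) (c.wild m₀ p.2) := by
  have weight_nonneg (n : ℕ) : 0 ≤ (1 - τ) * τ ^ n :=
    mul_nonneg (sub_pos.2 hτ.2).le (pow_nonneg hτ.1 n)
  rw [collision, wildSum, Measure.prod_sum,
    Measure.map_sum c.measurable_collide.aemeasurable]
  congr 1 with p : 1
  rw [Measure.prod_smul_left, Measure.prod_smul_right, smul_smul,
    ← ENNReal.ofReal_mul (weight_nonneg _), Measure.map_smul, collision]
  congr 2
  ring

theorem integral_collision_wildSum (hτ : τ ∈ Set.Ico 0 1) (hh : BoundedBy h C) :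
    ∫ x, h x ∂(c.collision (c.wildSum m₀ τ) (c.wildSum m₀ τ)) =
      (1 - τ) ^ 2 * ∑' n : ℕ, τ ^ n * ((n + 1) * ∫ x, h x ∂(c.wild m₀ (n + 1))) := by
  have := c.isProbabilityMeasure_wildSum m₀ hτ
  have hint := hh.integrable (c.collision (c.wildSum m₀ τ) (c.wildSum m₀ τ))
  rw [c.collision_wildSum m₀ hτ] at hint ⊢
  rw [← (Finset.HasAntidiagonal.sigmaAntidiagonalEquivProd.hasSum_iff.2
    (hasSum_integral_measure hint)).tsum_eq,
    (Finset.HasAntidiagonal.sigmaAntidiagonalEquivProd.hasSum_iff.2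
      (hasSum_integral_measure hint)).summable.tsum_sigma' fun n => Summable.of_finite,
    ← tsum_mul_left]
  refine tsum_congr fun n => ?_
  rw [c.integral_wild_succ m₀ hh, ← mul_assoc, Finset.mul_sum, tsum_fintype,
    ← Finset.sum_coe_sort (Finset.HasAntidiagonal.antidiagonal n)]
  refine Finset.sum_congr rfl fun p _ => ?_
  rw [Function.comp_apply, Finset.HasAntidiagonal.sigmaAntidiagonalEquivProd_apply,
    integral_smul_measure, ENNReal.toReal_ofReal (mul_nonneg (by positivity) (pow_nonneg hτ.1 _)),
    smul_eq_mul, Finset.HasAntidiagonal.mem_antidiagonal.1 p.2]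

variable (r : ℝ≥0)

/-- The solution to the kinetic equation given by its Wild sum. -/
def wildSolution (t : ℝ≥0) : ProbabilityMeasure S :=
  ⟨c.wildSum m₀ (1 - Real.exp (-(r * t))), c.isProbabilityMeasure_wildSum m₀
    (one_sub_exp_neg_mem_Ico r t)⟩

theorem wildSolution_zero : c.wildSolution m₀ r 0 = m₀ := by
  refine ProbabilityMeasure.toMeasure_injective (ext_of_integral_eq fun h hh => ?_)
  have : (c.wildSolution m₀ r 0 : Measure S) = c.wildSum m₀ 0 := by simp [wildSolution]
  rw [this, c.integral_wildSum m₀ ⟨le_rfl, zero_lt_one⟩ hh, tsum_eq_single 0 (by simp +contextual)]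
  simp [wild]

/-- `⟨h, m(s)⟩` for the Wild sum `m`, as a function of `q n = ⟨h, wild n⟩` and of a real time. -/
def wildSeries (r : ℝ≥0) (q : ℕ → ℝ) (s : ℝ) : ℝ :=
  Real.exp (-(r * s)) * ∑' n, (1 - Real.exp (-(r * s))) ^ n * q n

variable {r}

theorem integral_wildSolution (hh : BoundedBy h C) (t : ℝ≥0) :
    ∫ x, h x ∂(c.wildSolution m₀ r t : Measure S) =
      wildSeries r (fun n => ∫ x, h x ∂(c.wild m₀ n)) t := by
  have hexp := c.integral_wildSum m₀ (one_sub_exp_neg_mem_Ico r t) hh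
  rwa [sub_sub_cancel] at hexp

theorem hasDerivAt_wildSeries (hh : BoundedBy h C) (t : ℝ≥0) :
    HasDerivAt (wildSeries r fun n => ∫ x, h x ∂(c.wild m₀ n))
      (∫ x, c.generator r (c.wildSolution m₀ r t) h x ∂(c.wildSolution m₀ r t : Measure S)) t := by
  have hτ := one_sub_exp_neg_mem_Ico r t
  have hexp : HasDerivAt (fun s : ℝ => Real.exp (-(r * s))) (Real.exp (-(r * t)) * -r) t := by
    simpa using (((hasDerivAt_id (t : ℝ)).const_mul (r : ℝ)).neg).exp
  have hseries := (hasDerivAt_tsum_pow_mul (fun n => hh.abs_integral_le (c.wild m₀ n))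
    (by rw [abs_of_nonneg hτ.1]; exact hτ.2)).comp (t : ℝ) (hexp.const_sub 1)
  refine (hexp.mul hseries).congr_deriv ?_
  rw [integral_generator hh, integral_wildSolution c m₀ hh]
  simp only [wildSolution, ProbabilityMeasure.coe_mk, Function.comp_apply, wildSeries]
  rw [c.integral_collision_wildSum m₀ hτ hh]
  ring

theorem isSolution_wildSolution : c.IsSolution r m₀ (c.wildSolution m₀ r) := by
  refine ⟨c.wildSolution_zero m₀ r, fun h hh t => ?_⟩
  obtain ⟨C, hh⟩ := isBoundedMeasurable_iff.1 hh
  have hderiv : ∀ s ∈ Set.uIcc (0 : ℝ) t,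
      HasDerivAt (wildSeries r fun n => ∫ x, h x ∂(c.wild m₀ n))
        (∫ x, c.generator r (c.wildSolution m₀ r s.toNNReal) h x
          ∂(c.wildSolution m₀ r s.toNNReal : Measure S)) s := by
    intro s hs
    rw [Set.uIcc_of_le t.coe_nonneg] at hs
    lift s to ℝ≥0 using hs.1
    simpa using c.hasDerivAt_wildSeries m₀ hh s
  have hint := intervalIntegrable_of_hasDerivAt_of_abs_le hderiv fun s =>
    (c.boundedBy_generator r _ hh).abs_integral_le _
  refine ⟨hint, ?_⟩
  rw [intervalIntegral.integral_eq_sub_of_hasDerivAt hderiv hint, integral_wildSolution c m₀ hh,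
    integral_wildSolution c m₀ hh, NNReal.coe_zero]

end CollisionRule

end WildSum

section PathMeasurability

theorem tendsto_ceil_mul_div_min (s t : ℝ≥0) :
    Tendsto (fun n : ℕ => min ((⌈s * n⌉₊ : ℝ≥0) / n) t) atTop (𝓝[≥] (min s t)) := by
  refine tendsto_nhdsWithin_iff.2 ⟨Tendsto.min ?_ tendsto_const_nhds, ?_⟩
  · have ceil_coe (n : ℕ) : ⌈(s : ℝ) * n⌉₊ = ⌈s * (n : ℝ≥0)⌉₊ := Nonneg.nat_ceil_coe (s * (n : ℝ≥0))
    have := (tendsto_nat_ceil_mul_div_atTop s.coe_nonneg).comp tendsto_natCast_atTop_atTop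
    simp only [Function.comp_def, ceil_coe] at this
    rw [← NNReal.tendsto_coe]
    simpa only [NNReal.coe_div, NNReal.coe_natCast] using this
  · filter_upwards [eventually_gt_atTop 0] with n hn
    refine min_le_min_right t ((le_div_iff₀ (by positivity)).2 (Nat.le_ceil _))

variable {S Ω : Type*} [TopologicalSpace S] [TopologicalSpace.PseudoMetrizableSpace S]
  [MeasurableSpace S] [BorelSpace S] [MeasurableSpace Ω] {X : ℝ≥0 → Ω → S}

theorem measurable_uncurry_min (t : ℝ≥0) (hX : ∀ u ≤ t, Measurable (X u))
    (hr : ∀ ω u, ContinuousWithinAt (fun v => X v ω) (Set.Ici u) u) :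
    Measurable fun p : ℝ≥0 × Ω => X (min p.1 t) p.2 := by
  have measurable_approx (n : ℕ) :
      Measurable fun p : ℝ≥0 × Ω => X (min ((⌈p.1 * n⌉₊ : ℝ≥0) / n) t) p.2 := by
    have : Measurable fun q : Ω × ℕ => X (min ((q.2 : ℝ≥0) / n) t) q.1 :=
      measurable_from_prod_countable_left fun k =>
        show Measurable (X (min ((k : ℝ≥0) / n) t)) from hX _ (min_le_right _ _)
    exact this.comp (f := fun p : ℝ≥0 × Ω => (p.2, ⌈p.1 * (n : ℝ≥0)⌉₊)) (by fun_prop)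
  refine measurable_of_tendsto_metrizable measurable_approx (tendsto_pi_nhds.2 fun p => ?_)
  exact (hr p.2 (min p.1 t)).tendsto.comp (tendsto_ceil_mul_div_min p.1 t)

theorem measurable_uncurry_of_rightContinuous (hX : ∀ u, Measurable (X u))
    (hr : ∀ ω u, ContinuousWithinAt (fun v => X v ω) (Set.Ici u) u) :
    Measurable fun p : ℝ≥0 × Ω => X p.1 p.2 := by
  refine measurable_of_tendsto_metrizable
    (fun n : ℕ => measurable_uncurry_min (n : ℝ≥0) (fun u _ => hX u) hr)
    (tendsto_pi_nhds.2 fun p => tendsto_const_nhds.congr' ?_)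
  filter_upwards [tendsto_natCast_atTop_atTop.eventually_ge_atTop p.1] with n hn
  rw [min_eq_left hn]

theorem measurable_integral_path (t : ℝ≥0) (hX : ∀ u ≤ t, Measurable (X u))
    (hr : ∀ ω u, ContinuousWithinAt (fun v => X v ω) (Set.Ici u) u) {a : ℝ≥0 × S → ℝ}
    (ha : Measurable a) :
    Measurable fun ω => ∫ s in (0 : ℝ)..t, a (s.toNNReal, X s.toNNReal ω) := by
  have integral_stopped (ω : Ω) : ∫ s in (0 : ℝ)..t, a (s.toNNReal, X s.toNNReal ω) =
      ∫ s in Set.Ioc (0 : ℝ) t, a (s.toNNReal, X (min s.toNNReal t) ω) := by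
    rw [intervalIntegral.integral_of_le t.coe_nonneg]
    refine setIntegral_congr_fun measurableSet_Ioc fun s hs => ?_
    simp only [min_eq_left (Real.toNNReal_le_iff_le_coe.2 hs.2)]
  simp_rw [integral_stopped]
  have measurable_stopped :
      Measurable fun p : Ω × ℝ => a (p.2.toNNReal, X (min p.2.toNNReal t) p.1) :=
    ha.comp (Measurable.prodMk (by fun_prop) ((measurable_uncurry_min t hX hr).comp
      (by fun_prop : Measurable fun p : Ω × ℝ => (p.2.toNNReal, p.1))))
  exact measurable_stopped.stronglyMeasurable.integral_prod_right.measurable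

end PathMeasurability

section BoundedRate

variable {S : Type*} [MeasurableSpace S]

theorem BoundedBy.intervalIntegrable {f : ℝ → ℝ} {C : ℝ} (hf : BoundedBy f C) (a b : ℝ) :
    IntervalIntegrable f volume a b :=
  intervalIntegrable_iff.2 (IntegrableOn.of_bound measure_Ioc_lt_top
    hf.measurable.aestronglyMeasurable C (Eventually.of_forall hf.abs_le))

theorem integral_comp_add_toNNReal (f : ℝ≥0 → ℝ) (s t : ℝ≥0) :
    ∫ r in (0 : ℝ)..t, f (s + r.toNNReal) = ∫ r in (s : ℝ)..(s + t : ℝ≥0), f r.toNNReal := by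
  have shift : ∫ r in (0 : ℝ)..t, f (s + r.toNNReal) = ∫ r in (0 : ℝ)..t, f (s + r).toNNReal := by
    refine intervalIntegral.integral_congr fun r hr => ?_
    rw [Set.uIcc_of_le t.coe_nonneg] at hr
    simp only [Real.toNNReal_add s.coe_nonneg hr.1, Real.toNNReal_coe]
  rw [shift, intervalIntegral.integral_comp_add_left (fun r : ℝ => f r.toNNReal), add_zero,
    NNReal.coe_add]

/-- Time-dependent operators on bounded measurable functions that depend measurably on time and
have norm at most `l`. -/
def IsBoundedRate (A : ℝ≥0 → (S → ℝ) → S → ℝ) (l : ℝ) : Prop :=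
  ∀ h C, BoundedBy h C → BoundedBy (fun p : ℝ≥0 × S => A p.1 h p.2) (l * C)

/-- Functionals `ν t` on bounded measurable functions, of norm at most `K`, that solve the linear
equation `d/dt ν t h = ν t (A t h)` in its integrated form. -/
structure IsLinearFlow (A : ℝ≥0 → (S → ℝ) → S → ℝ) (ν : ℝ≥0 → (S → ℝ) → ℝ) (K : ℝ) : Prop where
  abs_le : ∀ t h C, BoundedBy h C → |ν t h| ≤ K * C
  intervalIntegrable : ∀ h C, BoundedBy h C → ∀ t : ℝ≥0,
    IntervalIntegrable (fun r : ℝ => ν r.toNNReal (A r.toNNReal h)) volume 0 t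
  sub_eq_integral : ∀ h C, BoundedBy h C → ∀ t : ℝ≥0,
    ν t h - ν 0 h = ∫ r in (0 : ℝ)..t, ν r.toNNReal (A r.toNNReal h)

variable {A : ℝ≥0 → (S → ℝ) → S → ℝ} {l C : ℝ} {h : S → ℝ}

theorem IsBoundedRate.shift (hA : IsBoundedRate A l) (s : ℝ≥0) :
    IsBoundedRate (fun r => A (s + r)) l := fun h C hh =>
  (hA h C hh).comp (f := fun p : ℝ≥0 × S => (s + p.1, p.2)) (by fun_prop)

theorem IsLinearFlow.unique [Nonempty S] (hA : IsBoundedRate A l) {ν ν' : ℝ≥0 → (S → ℝ) → ℝ}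
    {K K' : ℝ} (hν : IsLinearFlow A ν K) (hν' : IsLinearFlow A ν' K')
    (h₀ : ∀ h C, BoundedBy h C → ν 0 h = ν' 0 h) (t : ℝ≥0) (hh : BoundedBy h C) :
    ν t h = ν' t h := by
  have gronwall : IsGronwallFamily (fun t h => ν t h - ν' t h) (K + K') l 0 := by
    refine ⟨fun t h C hh => ?_, fun h C hh => ⟨fun r => A r h, fun r =>
      (hA h C hh).comp measurable_prodMk_left, fun t => ?_⟩⟩
    · rw [add_mul]
      exact (abs_sub _ _).trans (add_le_add (hν.abs_le t h C hh) (hν'.abs_le t h C hh))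
    · rw [intervalIntegral.integral_sub (hν.intervalIntegrable h C hh t)
        (hν'.intervalIntegrable h C hh t), ← hν.sub_eq_integral h C hh,
        ← hν'.sub_eq_integral h C hh, h₀ h C hh]
      simp
  simpa [sub_eq_zero] using gronwall.abs_le_exp le_rfl t hh

namespace CollisionRule.IsSolution

variable {c : CollisionRule S} {r : ℝ≥0} {m₀ : ProbabilityMeasure S}
  {m : ℝ≥0 → ProbabilityMeasure S}

theorem measurable (hm : c.IsSolution r m₀ m) : Measurable fun t => (m t : Measure S) := by
  refine Measure.measurable_of_measurable_coe _ fun s hs => ?_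
  have continuous_real : Continuous fun t => (m t : Measure S).real s := by
    refine (LipschitzWith.of_dist_le_mul (K := 2 * r) fun u v => ?_).continuous
    simpa [Real.dist_eq, NNReal.dist_eq, integral_indicator_one hs] using
      hm.abs_integral_sub_le (boundedBy_indicator_one hs) u v
  simpa [Measure.real] using continuous_real.measurable.ennreal_ofReal

theorem isBoundedRate (hm : c.IsSolution r m₀ m) :
    IsBoundedRate (fun t => c.generator r (m t)) (2 * r) := by
  refine fun h C hh => ⟨?_, fun p => (c.boundedBy_generator r (m p.1) hh).abs_le p.2⟩
  let κ : Kernel (ℝ≥0 × S) S :=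
    ⟨fun p => (m p.1 : Measure S), hm.measurable.comp measurable_fst⟩
  have : IsMarkovKernel κ := ⟨fun p => (inferInstance : IsProbabilityMeasure (m p.1 : Measure S))⟩
  have measurable_post : StronglyMeasurable fun q : (ℝ≥0 × S) × S => h (c.collide q.1.2 q.2) :=
    ((c.boundedBy_comp_collide hh).measurable.comp
      ((measurable_snd.comp measurable_fst).prodMk measurable_snd)).stronglyMeasurable
  simp_rw [generator_eq hh]
  exact (((StronglyMeasurable.integral_kernel_prod_right' (κ := κ)
    measurable_post).measurable).sub (hh.measurable.comp measurable_snd)).const_mul _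

theorem isLinearFlow (hm : c.IsSolution r m₀ m) :
    IsLinearFlow (fun t => c.generator r (m t)) (fun t h => ∫ x, h x ∂(m t : Measure S)) 1 where
  abs_le t h C hh := by simpa using hh.abs_integral_le (m t : Measure S)
  intervalIntegrable h C hh t := (hm.2 h hh.isBoundedMeasurable t).1
  sub_eq_integral h C hh t := (hm.2 h hh.isBoundedMeasurable t).2

end CollisionRule.IsSolution

end BoundedRate

section MartingaleProblem

variable {S Ω : Type*} [MeasurableSpace S] {mΩ : MeasurableSpace Ω} {P : Measure Ω} {ξ : Ω → ℝ}
  {C : ℝ}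

theorem BoundedBy.integrable_mul {g : Ω → ℝ} (hg : BoundedBy g C) (hξ : Integrable ξ P) :
    Integrable (fun ω => ξ ω * g ω) P :=
  hξ.mul_bdd hg.measurable.aestronglyMeasurable (Eventually.of_forall hg.abs_le)

theorem BoundedBy.abs_integral_mul_le {g : Ω → ℝ} (hg : BoundedBy g C) (hξ : Integrable ξ P) :
    |∫ ω, ξ ω * g ω ∂P| ≤ (∫ ω, |ξ ω| ∂P) * C :=
  calc |∫ ω, ξ ω * g ω ∂P| ≤ ∫ ω, |ξ ω * g ω| ∂P := abs_integral_le_integral_abs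
    _ ≤ ∫ ω, |ξ ω| * C ∂P := by
      refine integral_mono (hg.integrable_mul hξ).abs (hξ.abs.mul_const C) fun ω => ?_
      simpa only [abs_mul] using mul_le_mul_of_nonneg_left (hg.abs_le ω) (abs_nonneg (ξ ω))
    _ = (∫ ω, |ξ ω| ∂P) * C := integral_mul_const C _

theorem BoundedBy.integrable_mul_comp_snd [SFinite P] {g : ℝ × Ω → ℝ} (hg : BoundedBy g C)
    (hξ : Integrable ξ P) (a b : ℝ) :
    Integrable (fun p : ℝ × Ω => ξ p.2 * g p) ((volume.restrict (Set.uIoc a b)).prod P) :=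
  have : IsFiniteMeasure (volume.restrict (Set.uIoc a b)) :=
    isFiniteMeasure_restrict.2 measure_Ioc_lt_top.ne
  hg.integrable_mul (hξ.comp_snd _)

theorem integral_mul_martingale_sub {ι : Type*} [Preorder ι] {ℱ : Filtration ι mΩ}
    [SigmaFiniteFiltration P ℱ] {M : ι → Ω → ℝ} (hM : Martingale M ℱ P) {s t : ι} (hst : s ≤ t)
    (hξ : StronglyMeasurable[ℱ s] ξ) (hint : Integrable (ξ * (M t - M s)) P) :
    ∫ ω, ξ ω * (M t ω - M s ω) ∂P = 0 := by
  have increment : P[M t - M s | ℱ s] =ᵐ[P] 0 := by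
    filter_upwards [condExp_sub (hM.integrable t) (hM.integrable s) (ℱ s), hM.condExp_ae_eq hst,
      hM.condExp_ae_eq (le_refl s)] with ω hsub ht hs
    simp [hsub, ht, hs]
  have weighted : P[ξ * (M t - M s) | ℱ s] =ᵐ[P] 0 := by
    filter_upwards [condExp_mul_of_stronglyMeasurable_left hξ hint
      ((hM.integrable t).sub (hM.integrable s)), increment] with ω hmul hω
    simp [hmul, hω]
  calc ∫ ω, ξ ω * (M t ω - M s ω) ∂P = ∫ ω, (P[ξ * (M t - M s) | ℱ s]) ω ∂P :=
        (integral_condExp (ℱ.le s)).symm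
    _ = 0 := by rw [integral_congr_ae weighted]; simp

/-- The process `h (X t) - h (X 0) - ∫₀ᵗ A s h (X s) ds`, whose being a martingale says that `X`
has generator `A s` at time `s`. -/
def dynkin (A : ℝ≥0 → (S → ℝ) → S → ℝ) (X : ℝ≥0 → Ω → S) (h : S → ℝ) (t : ℝ≥0) (ω : Ω) : ℝ :=
  h (X t ω) - h (X 0 ω) - ∫ s in (0 : ℝ)..t, A s.toNNReal h (X s.toNNReal ω)

/-- A jointly measurable adapted process that solves the martingale problem for `A`. The initial
law is left free. -/
structure SolvesMartingaleProblem (A : ℝ≥0 → (S → ℝ) → S → ℝ) (X : ℝ≥0 → Ω → S)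
    (ℱ : Filtration ℝ≥0 mΩ) (P : Measure Ω) : Prop where
  measurable : Measurable fun p : ℝ≥0 × Ω => X p.1 p.2
  adapted : ∀ t, Measurable[ℱ t] (X t)
  martingale : ∀ h, IsBoundedMeasurable h → Martingale (dynkin A X h) ℱ P

variable {A : ℝ≥0 → (S → ℝ) → S → ℝ} {l : ℝ} {X : ℝ≥0 → Ω → S} {h : S → ℝ}

theorem IsBoundedRate.boundedBy_path (hA : IsBoundedRate A l)
    (hX : Measurable fun p : ℝ≥0 × Ω => X p.1 p.2) (hh : BoundedBy h C) :
    BoundedBy (fun p : ℝ × Ω => A p.1.toNNReal h (X p.1.toNNReal p.2)) (l * C) :=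
  (hA h C hh).comp (f := fun p : ℝ × Ω => (p.1.toNNReal, X p.1.toNNReal p.2))
    ((by fun_prop : Measurable fun p : ℝ × Ω => p.1.toNNReal).prodMk
      (hX.comp (by fun_prop : Measurable fun p : ℝ × Ω => (p.1.toNNReal, p.2))))

theorem dynkin_sub (hA : IsBoundedRate A l) (hX : Measurable fun p : ℝ≥0 × Ω => X p.1 p.2)
    (hh : BoundedBy h C) (s t : ℝ≥0) (ω : Ω) :
    dynkin A X h t ω - dynkin A X h s ω = h (X t ω) - h (X s ω)
      - ∫ r in (s : ℝ)..t, A r.toNNReal h (X r.toNNReal ω) := by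
  have integrable (u : ℝ≥0) :
      IntervalIntegrable (fun r : ℝ => A r.toNNReal h (X r.toNNReal ω)) volume 0 u :=
    ((hA.boundedBy_path hX hh).comp (measurable_prodMk_right (y := ω))).intervalIntegrable 0 u
  rw [← intervalIntegral.integral_interval_sub_left (integrable t) (integrable s)]
  simp only [dynkin]
  ring

theorem measurable_dynkin_of_rightContinuous [TopologicalSpace S]
    [TopologicalSpace.PseudoMetrizableSpace S] [BorelSpace S] (hA : IsBoundedRate A l)
    (hh : BoundedBy h C) (t : ℝ≥0) (hX : ∀ u ≤ t, Measurable (X u))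
    (hr : ∀ ω u, ContinuousWithinAt (fun v => X v ω) (Set.Ici u) u) :
    Measurable (dynkin A X h t) :=
  ((hh.measurable.comp (hX t le_rfl)).sub (hh.measurable.comp (hX 0 zero_le))).sub
    (measurable_integral_path t hX hr (hA h C hh).measurable)

namespace SolvesMartingaleProblem

variable {ℱ : Filtration ℝ≥0 mΩ}

theorem measurable_apply (hX : SolvesMartingaleProblem A X ℱ P) (t : ℝ≥0) : Measurable (X t) :=
  (hX.adapted t).mono (ℱ.le t) le_rfl

theorem stronglyMeasurable_prod (hX : SolvesMartingaleProblem A X ℱ P) {f : ℝ≥0 → S → ℝ}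
    (hf : ∀ j, BoundedBy (f j) 1) {J : Finset ℝ≥0} {s : ℝ≥0} (hJ : ∀ j ∈ J, j ≤ s) :
    StronglyMeasurable[ℱ s] fun ω => ∏ j ∈ J, f j (X j ω) :=
  (Finset.measurable_prod (m := ℱ s) _ fun j hj => (hf j).measurable.comp
    ((hX.adapted j).mono (ℱ.mono (hJ j hj)) le_rfl)).stronglyMeasurable

variable [IsFiniteMeasure P]

theorem integrable_prod (hX : SolvesMartingaleProblem A X ℱ P) {f : ℝ≥0 → S → ℝ}
    (hf : ∀ j, BoundedBy (f j) 1) (J : Finset ℝ≥0) :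
    Integrable (fun ω => ∏ j ∈ J, f j (X j ω)) P := by
  refine BoundedBy.integrable (C := 1) ⟨Finset.measurable_prod _ fun j _ =>
    (hf j).measurable.comp (hX.measurable_apply j), fun ω => ?_⟩ P
  rw [Finset.abs_prod]
  exact Finset.prod_le_one (fun _ _ => abs_nonneg _) fun j _ => (hf j).abs_le _

theorem integral_mul_sub_eq (hX : SolvesMartingaleProblem A X ℱ P) (hA : IsBoundedRate A l)
    {s t : ℝ≥0} (hst : s ≤ t) (hξ : StronglyMeasurable[ℱ s] ξ) (hξi : Integrable ξ P)
    (hh : BoundedBy h C) :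
    (∫ ω, ξ ω * h (X t ω) ∂P) - ∫ ω, ξ ω * h (X s ω) ∂P =
      ∫ r in (s : ℝ)..t, ∫ ω, ξ ω * A r.toNNReal h (X r.toNNReal ω) ∂P := by
  have state_integrable (u : ℝ≥0) : Integrable (fun ω => ξ ω * h (X u ω)) P :=
    (hh.comp (hX.measurable_apply u)).integrable_mul hξi
  have increment_integrable : Integrable (fun ω => ξ ω * h (X t ω) - ξ ω * h (X s ω)) P :=
    (state_integrable t).sub (state_integrable s)
  have rate_integrable : Integrable (fun p : ℝ × Ω => ξ p.2 * A p.1.toNNReal h (X p.1.toNNReal p.2))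
      ((volume.restrict (Set.uIoc (s : ℝ) t)).prod P) :=
    (hA.boundedBy_path hX.measurable hh).integrable_mul_comp_snd hξi s t
  have drift_integrable :
      Integrable (fun ω => ∫ r in (s : ℝ)..t, ξ ω * A r.toNNReal h (X r.toNNReal ω)) P := by
    simp_rw [intervalIntegral.intervalIntegral_eq_integral_uIoc]
    exact rate_integrable.integral_prod_right.smul (if (s : ℝ) ≤ t then 1 else -1 : ℝ)
  have expand (ω : Ω) : ξ ω * (dynkin A X h t ω - dynkin A X h s ω) =
      ξ ω * h (X t ω) - ξ ω * h (X s ω)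
        - ∫ r in (s : ℝ)..t, ξ ω * A r.toNNReal h (X r.toNNReal ω) := by
    rw [dynkin_sub hA hX.measurable hh, intervalIntegral.integral_const_mul]
    ring
  have centred := integral_mul_martingale_sub (hX.martingale h hh.isBoundedMeasurable) hst hξ
    ((increment_integrable.sub drift_integrable).congr
      (Eventually.of_forall fun ω => (expand ω).symm))
  simp_rw [expand] at centred
  rwa [integral_sub increment_integrable drift_integrable,
    integral_sub (state_integrable t) (state_integrable s), sub_eq_zero,
    ← intervalIntegral_integral_swap rate_integrable] at centred

theorem isLinearFlow (hX : SolvesMartingaleProblem A X ℱ P) (hA : IsBoundedRate A l) {s : ℝ≥0}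
    (hξ : StronglyMeasurable[ℱ s] ξ) (hξi : Integrable ξ P) :
    IsLinearFlow (fun r => A (s + r)) (fun r h => ∫ ω, ξ ω * h (X (s + r) ω) ∂P)
      (∫ ω, |ξ ω| ∂P) where
  abs_le t h C hh := (hh.comp (hX.measurable_apply (s + t))).abs_integral_mul_le hξi
  intervalIntegrable h C hh t := by
    have rate : BoundedBy (fun p : ℝ × Ω => A (s + p.1.toNNReal) h (X (s + p.1.toNNReal) p.2))
        (l * C) :=
      (hA.shift s).boundedBy_path (X := fun r => X (s + r))
        (hX.measurable.comp (f := fun p : ℝ≥0 × Ω => (s + p.1, p.2)) (by fun_prop)) hh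
    refine intervalIntegrable_iff.2 (Integrable.integral_prod_left
      (f := fun p : ℝ × Ω => ξ p.2 * A (s + p.1.toNNReal) h (X (s + p.1.toNNReal) p.2)) ?_)
    exact rate.integrable_mul_comp_snd hξi 0 t
  sub_eq_integral h C hh t := by
    rw [add_zero, hX.integral_mul_sub_eq hA le_self_add hξ hξi hh,
      integral_comp_add_toNNReal fun r => ∫ ω, ξ ω * A r h (X r ω) ∂P]

theorem integral_mul_eq_of_le {Ω' : Type*} {mΩ' : MeasurableSpace Ω'} {P' : Measure Ω'}
    [IsFiniteMeasure P'] {X' : ℝ≥0 → Ω' → S} {ℱ' : Filtration ℝ≥0 mΩ'} {ξ' : Ω' → ℝ}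
    [Nonempty S] (hA : IsBoundedRate A l) (hX : SolvesMartingaleProblem A X ℱ P)
    (hX' : SolvesMartingaleProblem A X' ℱ' P') {s t : ℝ≥0} (hst : s ≤ t)
    (hξ : StronglyMeasurable[ℱ s] ξ) (hξi : Integrable ξ P)
    (hξ' : StronglyMeasurable[ℱ' s] ξ') (hξi' : Integrable ξ' P')
    (heq : ∀ g C, BoundedBy g C → ∫ ω, ξ ω * g (X s ω) ∂P = ∫ ω, ξ' ω * g (X' s ω) ∂P')
    (hh : BoundedBy h C) :
    ∫ ω, ξ ω * h (X t ω) ∂P = ∫ ω, ξ' ω * h (X' t ω) ∂P' := by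
  simpa only [add_tsub_cancel_of_le hst] using (hX.isLinearFlow hA hξ hξi).unique (hA.shift s)
    (hX'.isLinearFlow hA hξ' hξi') (by simpa only [add_zero] using heq) (t - s) hh

end SolvesMartingaleProblem

end MartingaleProblem

section MarkovProperty

theorem integral_condExp_mul_of_stronglyMeasurable {Ω : Type*} {m mΩ : MeasurableSpace Ω}
    {P : Measure Ω} (hm : m ≤ mΩ) [SigmaFinite (P.trim hm)] {f g : Ω → ℝ} (hf : Integrable f P)
    (hg : StronglyMeasurable[m] g) (hfg : Integrable (f * g) P) :
    ∫ ω, (P[f | m]) ω * g ω ∂P = ∫ ω, f ω * g ω ∂P :=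
  calc ∫ ω, (P[f | m]) ω * g ω ∂P = ∫ ω, (P[f * g | m]) ω ∂P :=
        integral_congr_ae (condExp_mul_of_stronglyMeasurable_right hg hfg hf).symm
    _ = ∫ ω, f ω * g ω ∂P := integral_condExp hm

theorem BoundedBy.integral_condExp_mul {Ω : Type*} {m mΩ : MeasurableSpace Ω} {P : Measure Ω}
    [IsFiniteMeasure P] (hm : m ≤ mΩ) {f g : Ω → ℝ} {C : ℝ} (hf : Integrable f P)
    (hg : BoundedBy g C) : ∫ ω, (P[f | m]) ω * g ω ∂P = ∫ ω, f ω * (P[g | m]) ω ∂P := by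
  have bounded : ∀ᵐ ω ∂P, ‖(P[g | m]) ω‖ ≤ C :=
    ae_bdd_abs_condExp_of_ae_bdd_abs (Eventually.of_forall hg.abs_le)
  have measurable : AEStronglyMeasurable (P[g | m]) P := integrable_condExp.aestronglyMeasurable
  calc ∫ ω, (P[f | m]) ω * g ω ∂P = ∫ ω, g ω * (P[f | m]) ω ∂P := by simp_rw [mul_comm]
    _ = ∫ ω, (P[g | m]) ω * (P[f | m]) ω ∂P :=
      (integral_condExp_mul_of_stronglyMeasurable hm (hg.integrable P) stronglyMeasurable_condExp
        (integrable_condExp.bdd_mul hg.measurable.aestronglyMeasurable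
          (Eventually.of_forall hg.abs_le))).symm
    _ = ∫ ω, (P[f | m]) ω * (P[g | m]) ω ∂P := by simp_rw [mul_comm]
    _ = ∫ ω, f ω * (P[g | m]) ω ∂P :=
      integral_condExp_mul_of_stronglyMeasurable hm hf stronglyMeasurable_condExp
        (hf.mul_bdd measurable bounded)

variable {S Ω Ω' : Type*} [MeasurableSpace S] {mΩ : MeasurableSpace Ω}
  {mΩ' : MeasurableSpace Ω'} {P : Measure Ω} [IsProbabilityMeasure P] {P' : Measure Ω'}
  [IsProbabilityMeasure P'] {A : ℝ≥0 → (S → ℝ) → S → ℝ} {l C : ℝ} {X : ℝ≥0 → Ω → S}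
  {X' : ℝ≥0 → Ω' → S} {ℱ : Filtration ℝ≥0 mΩ} {ℱ' : Filtration ℝ≥0 mΩ'} {h : S → ℝ}

namespace SolvesMartingaleProblem

/- For `B` in the past of `s`, the weights `1_B` and `P[1_B | X s]` have the same integrals
against functions of `X s`, hence against functions of `X t`. -/
theorem condExp_ae_eq [Nonempty S] (hX : SolvesMartingaleProblem A X ℱ P)
    (hA : IsBoundedRate A l) {s t : ℝ≥0} (hst : s ≤ t) (hh : BoundedBy h C) :
    P[fun ω => h (X t ω) | ℱ s] =ᵐ[P]
      P[fun ω => h (X t ω) | MeasurableSpace.comap (X s) inferInstance] := by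
  have hle : MeasurableSpace.comap (X s) inferInstance ≤ ℱ s := (hX.adapted s).comap_le
  have hle' := hle.trans (ℱ.le s)
  have bounded (g : S → ℝ) (K : ℝ) (hg : BoundedBy g K) (u : ℝ≥0) :=
    hg.comp (hX.measurable_apply u)
  refine (ae_eq_condExp_of_forall_setIntegral_eq (ℱ.le s) ((bounded h C hh t).integrable P)
    (fun _ _ _ => integrable_condExp.integrableOn) (fun B hB _ => ?_)
    (stronglyMeasurable_condExp.mono hle).aestronglyMeasurable).symm
  have indicator_integrable : Integrable (B.indicator (1 : Ω → ℝ)) P :=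
    (boundedBy_indicator_one (ℱ.le s B hB)).integrable P
  have setIntegral_eq (f : Ω → ℝ) :
      ∫ ω in B, f ω ∂P = ∫ ω, B.indicator (1 : Ω → ℝ) ω * f ω ∂P := by
    simp_rw [← integral_indicator (ℱ.le s B hB), ← Set.indicator_mul_left, Pi.one_apply, one_mul]
  have weights_agree_at_s (g : S → ℝ) (K : ℝ) (hg : BoundedBy g K) :
      ∫ ω, B.indicator (1 : Ω → ℝ) ω * g (X s ω) ∂P =
        ∫ ω, (P[B.indicator (1 : Ω → ℝ) | MeasurableSpace.comap (X s) inferInstance]) ω *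
          g (X s ω) ∂P :=
    (integral_condExp_mul_of_stronglyMeasurable hle' indicator_integrable
      (hg.measurable.comp (comap_measurable (X s))).stronglyMeasurable
      ((bounded g K hg s).integrable_mul indicator_integrable)).symm
  calc ∫ ω in B, (P[fun ω => h (X t ω) | MeasurableSpace.comap (X s) inferInstance]) ω ∂P
    _ = ∫ ω, (P[B.indicator (1 : Ω → ℝ) | MeasurableSpace.comap (X s) inferInstance]) ω *
          h (X t ω) ∂P := by
      rw [setIntegral_eq]
      exact ((bounded h C hh t).integral_condExp_mul hle' indicator_integrable).symm
    _ = ∫ ω, B.indicator (1 : Ω → ℝ) ω * h (X t ω) ∂P :=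
      (integral_mul_eq_of_le hA hX hX hst (stronglyMeasurable_one.indicator hB)
        indicator_integrable (stronglyMeasurable_condExp.mono hle) integrable_condExp
        weights_agree_at_s hh).symm
    _ = ∫ ω in B, h (X t ω) ∂P := (setIntegral_eq _).symm

theorem map_eq_of_isLinearFlow [Nonempty S] (hX : SolvesMartingaleProblem A X ℱ P)
    (hA : IsBoundedRate A l) {m : ℝ≥0 → ProbabilityMeasure S} {K : ℝ}
    (hm : IsLinearFlow A (fun t h => ∫ x, h x ∂(m t : Measure S)) K)
    (h₀ : P.map (X 0) = (m 0 : Measure S)) (t : ℝ≥0) : P.map (X t) = (m t : Measure S) := by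
  have : IsProbabilityMeasure (P.map (X t)) :=
    Measure.isProbabilityMeasure_map (hX.measurable_apply t).aemeasurable
  have integral_eq (u : ℝ≥0) {g : S → ℝ} {K : ℝ} (hg : BoundedBy g K) :
      ∫ ω, g (X u ω) ∂P = ∫ x, g x ∂(P.map (X u)) :=
    (integral_map (hX.measurable_apply u).aemeasurable hg.measurable.aestronglyMeasurable).symm
  have flow := hX.isLinearFlow hA (s := 0) stronglyMeasurable_one (integrable_const (1 : ℝ))
  simp only [zero_add, Pi.one_apply, one_mul] at flow
  refine ext_of_integral_eq fun h hh => ?_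
  rw [← integral_eq t hh]
  exact flow.unique hA hm (fun g K hg => by rw [integral_eq 0 hg, h₀]) t hh

theorem integral_prod_mul_eq_of_le [Nonempty S] (hA : IsBoundedRate A l)
    (hX : SolvesMartingaleProblem A X ℱ P) (hX' : SolvesMartingaleProblem A X' ℱ' P')
    {f : ℝ≥0 → S → ℝ} (hf : ∀ j, BoundedBy (f j) 1) {J : Finset ℝ≥0} {s t : ℝ≥0}
    (hJ : ∀ j ∈ J, j ≤ s) (hst : s ≤ t)
    (heq : ∀ g C, BoundedBy g C → ∫ ω, (∏ j ∈ J, f j (X j ω)) * g (X s ω) ∂P =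
      ∫ ω, (∏ j ∈ J, f j (X' j ω)) * g (X' s ω) ∂P') (hh : BoundedBy h C) :
    ∫ ω, (∏ j ∈ J, f j (X j ω)) * h (X t ω) ∂P =
      ∫ ω, (∏ j ∈ J, f j (X' j ω)) * h (X' t ω) ∂P' :=
  integral_mul_eq_of_le hA hX hX' hst (hX.stronglyMeasurable_prod hf hJ) (hX.integrable_prod hf J)
    (hX'.stronglyMeasurable_prod hf hJ) (hX'.integrable_prod hf J) heq hh

theorem integral_prod_mul_eq [Nonempty S] (hA : IsBoundedRate A l)
    (hX : SolvesMartingaleProblem A X ℱ P) (hX' : SolvesMartingaleProblem A X' ℱ' P')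
    (h₀ : P.map (X 0) = P'.map (X' 0)) {f : ℝ≥0 → S → ℝ} (hf : ∀ j, BoundedBy (f j) 1)
    (J : Finset ℝ≥0) : ∀ t, (∀ j ∈ J, j ≤ t) → ∀ h C, BoundedBy h C →
      ∫ ω, (∏ j ∈ J, f j (X j ω)) * h (X t ω) ∂P =
        ∫ ω, (∏ j ∈ J, f j (X' j ω)) * h (X' t ω) ∂P' := by
  induction J using Finset.induction_on_max with
  | empty =>
    refine fun t _ h C hh => integral_prod_mul_eq_of_le hA hX hX' hf (s := 0) (by simp) zero_le
      (fun g C hg => ?_) hh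
    simp only [Finset.prod_empty, one_mul]
    rw [← integral_map (hX.measurable_apply 0).aemeasurable hg.measurable.aestronglyMeasurable,
      ← integral_map (hX'.measurable_apply 0).aemeasurable hg.measurable.aestronglyMeasurable, h₀]
  | insert a J ha ih =>
    have ha' : ∀ j ∈ insert a J, j ≤ a :=
      Finset.forall_mem_insert _ _ _ |>.2 ⟨le_rfl, fun j hj => (ha j hj).le⟩
    refine fun t ht h C hh => integral_prod_mul_eq_of_le hA hX hX' hf ha'
      (ht a (Finset.mem_insert_self a J)) (fun g C hg => ?_) hh
    simp_rw [Finset.prod_insert fun haJ => (ha a haJ).false, mul_comm (f a _), mul_assoc]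
    exact ih a (fun j hj => (ha j hj).le) (fun x => f a x * g x) _ ((hf a).mul hg)

end SolvesMartingaleProblem

end MarkovProperty

section PathLaw

theorem ext_of_integral_prod_eq {ι S : Type*} [MeasurableSpace S] {μ ν : Measure (ι → S)}
    [IsProbabilityMeasure μ] [IsProbabilityMeasure ν]
    (hμν : ∀ (J : Finset ι) (f : ι → S → ℝ), (∀ j, BoundedBy (f j) 1) →
      ∫ x, ∏ j ∈ J, f j (x j) ∂μ = ∫ x, ∏ j ∈ J, f j (x j) ∂ν) : μ = ν := by
  refine ext_of_generate_finite _ generateFrom_squareCylinders.symm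
    (isPiSystem_squareCylinders (fun _ => MeasurableSpace.isPiSystem_measurableSet)
      fun _ => by simp) ?_ (by rw [measure_univ, measure_univ])
  rintro _ ⟨J, B, hB, rfl⟩
  have hB (j : ι) : MeasurableSet (B j) := hB j (Set.mem_univ j)
  have hJB : MeasurableSet ((J : Set ι).pi B) := .pi J.countable_toSet fun j _ => hB j
  have key := hμν J (fun j => (B j).indicator 1) fun j => boundedBy_indicator_one (hB j)
  simp_rw [← Set.indicator_pi_one_apply] at key
  rw [integral_indicator_one hJB, integral_indicator_one hJB] at key
  exact (measureReal_eq_measureReal_iff).1 key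

variable {S : Type*} [TopologicalSpace S]

/-- The coordinate `X_t` of the canonical process on `D(ℝ₊, S)`; `coord` is the case
`S = [0,1]`. -/
def pathEval (t : ℝ≥0) (x : SkorokhodSpace S) : S := x.1 t

theorem rightContinuous_pathEval (x : SkorokhodSpace S) (u : ℝ≥0) :
    ContinuousWithinAt (fun v => pathEval v x) (Set.Ici u) u := (x.2 u).1

variable [MeasurableSpace S]

theorem measurable_pathEval (t : ℝ≥0) : Measurable (pathEval (S := S) t) :=
  (measurable_pi_apply t).comp measurable_subtype_coe

theorem pathMeasure_ext {Q Q' : ProbabilityMeasure (SkorokhodSpace S)}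
    (h : ∀ (J : Finset ℝ≥0) (f : ℝ≥0 → S → ℝ), (∀ j, BoundedBy (f j) 1) →
      ∫ x, ∏ j ∈ J, f j (pathEval j x) ∂(Q : Measure (SkorokhodSpace S)) =
        ∫ x, ∏ j ∈ J, f j (pathEval j x) ∂(Q' : Measure (SkorokhodSpace S))) : Q = Q' := by
  have isProbabilityMeasure_map (Q : ProbabilityMeasure (SkorokhodSpace S)) :
      IsProbabilityMeasure ((Q : Measure (SkorokhodSpace S)).map Subtype.val) :=
    Measure.isProbabilityMeasure_map measurable_subtype_coe.aemeasurable
  have hmap : (Q : Measure (SkorokhodSpace S)).map Subtype.val =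
      (Q' : Measure (SkorokhodSpace S)).map Subtype.val := by
    refine ext_of_integral_prod_eq fun J f hf => ?_
    have measurable_prod : Measurable fun x : ℝ≥0 → S => ∏ j ∈ J, f j (x j) :=
      Finset.measurable_prod _ fun j _ => (hf j).measurable.comp (measurable_pi_apply j)
    rw [integral_map measurable_subtype_coe.aemeasurable measurable_prod.aestronglyMeasurable,
      integral_map measurable_subtype_coe.aemeasurable measurable_prod.aestronglyMeasurable]
    exact h J f hf
  refine Subtype.ext (Measure.ext ?_)
  rintro _ ⟨T, hT, rfl⟩
  have := congrArg (fun μ => μ T) hmap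
  rwa [Measure.map_apply measurable_subtype_coe hT,
    Measure.map_apply measurable_subtype_coe hT] at this

variable [PolishSpace S] [BorelSpace S]

theorem measurable_uncurry_pathEval :
    Measurable fun p : ℝ≥0 × SkorokhodSpace S => pathEval p.1 p.2 :=
  measurable_uncurry_of_rightContinuous measurable_pathEval rightContinuous_pathEval

/-- The natural filtration of the canonical process on `D(ℝ₊, S)`; `canonicalFiltration` is the
case `S = [0,1]`. -/
def pathFiltration (S : Type*) [TopologicalSpace S] [MeasurableSpace S] [PolishSpace S]
    [BorelSpace S] : Filtration ℝ≥0 (inferInstance : MeasurableSpace (SkorokhodSpace S)) :=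
  Filtration.natural pathEval fun t => (measurable_pathEval t).stronglyMeasurable

theorem measurable_pathEval_pathFiltration {s t : ℝ≥0} (hst : s ≤ t) :
    Measurable[pathFiltration S t] (pathEval (S := S) s) :=
  ((Filtration.stronglyAdapted_natural fun t =>
    (measurable_pathEval t).stronglyMeasurable).stronglyMeasurable_le hst).measurable

variable {A : ℝ≥0 → (S → ℝ) → S → ℝ} {l C : ℝ} {m₀ : ProbabilityMeasure S}
  {Q Q' : ProbabilityMeasure (SkorokhodSpace S)} {h : S → ℝ}

theorem measurable_dynkin_pathEval (hA : IsBoundedRate A l) (hh : BoundedBy h C) (t : ℝ≥0) :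
    Measurable[pathFiltration S t] (dynkin A pathEval h t) :=
  measurable_dynkin_of_rightContinuous (mΩ := pathFiltration S t) hA hh t
    (fun _ hu => measurable_pathEval_pathFiltration hu) rightContinuous_pathEval

/-- `Q` is the law on `D(ℝ₊, S)` of a Markov process with initial law `m₀` and generator `A t` at
time `t`; `IsMarkovLaw` is the case `S = [0,1]`. -/
structure IsMarkovPathLaw (A : ℝ≥0 → (S → ℝ) → S → ℝ) (m₀ : ProbabilityMeasure S)
    (Q : ProbabilityMeasure (SkorokhodSpace S)) : Prop where
  initial : (Q : Measure (SkorokhodSpace S)).map (pathEval 0) = (m₀ : Measure S)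
  markov : ∀ h : S → ℝ, IsBoundedMeasurable h → ∀ s t : ℝ≥0, s ≤ t →
    (Q : Measure (SkorokhodSpace S))[fun x => h (pathEval t x) | pathFiltration S s]
      =ᵐ[(Q : Measure (SkorokhodSpace S))]
    (Q : Measure (SkorokhodSpace S))[fun x => h (pathEval t x) |
      MeasurableSpace.comap (pathEval s) inferInstance]
  generator : ∀ h : S → ℝ, IsBoundedMeasurable h →
    Martingale (dynkin A pathEval h) (pathFiltration S) (Q : Measure (SkorokhodSpace S))

theorem solvesMartingaleProblem_pathEval (hQ : ∀ h : S → ℝ, IsBoundedMeasurable h →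
      Martingale (dynkin A pathEval h) (pathFiltration S) (Q : Measure (SkorokhodSpace S))) :
    SolvesMartingaleProblem A pathEval (pathFiltration S) (Q : Measure (SkorokhodSpace S)) :=
  ⟨measurable_uncurry_pathEval, fun _ => measurable_pathEval_pathFiltration le_rfl, hQ⟩

namespace IsMarkovPathLaw

theorem of_martingale [Nonempty S] (hA : IsBoundedRate A l)
    (h₀ : (Q : Measure (SkorokhodSpace S)).map (pathEval 0) = (m₀ : Measure S))
    (hQ : ∀ h : S → ℝ, IsBoundedMeasurable h →
      Martingale (dynkin A pathEval h) (pathFiltration S) (Q : Measure (SkorokhodSpace S))) :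
    IsMarkovPathLaw A m₀ Q where
  initial := h₀
  markov h hh s t hst := by
    obtain ⟨C, hC⟩ := isBoundedMeasurable_iff.1 hh
    exact (solvesMartingaleProblem_pathEval hQ).condExp_ae_eq hA hst hC
  generator := hQ

theorem unique [Nonempty S] (hA : IsBoundedRate A l) (hQ : IsMarkovPathLaw A m₀ Q)
    (hQ' : IsMarkovPathLaw A m₀ Q') : Q = Q' := by
  refine pathMeasure_ext fun J f hf => ?_
  simpa using (solvesMartingaleProblem_pathEval hQ.generator).integral_prod_mul_eq hA
    (solvesMartingaleProblem_pathEval hQ'.generator) (hQ.initial.trans hQ'.initial.symm) hf J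
    (J.sup id) (fun j hj => Finset.le_sup (f := id) hj) (fun _ => 1) 1 ⟨measurable_const, by simp⟩

theorem map_pathEval [Nonempty S] (hA : IsBoundedRate A l) (hQ : IsMarkovPathLaw A m₀ Q)
    {m : ℝ≥0 → ProbabilityMeasure S} {K : ℝ}
    (hm : IsLinearFlow A (fun t h => ∫ x, h x ∂(m t : Measure S)) K) (h₀ : m 0 = m₀) (t : ℝ≥0) :
    (Q : Measure (SkorokhodSpace S)).map (pathEval t) = (m t : Measure S) :=
  (solvesMartingaleProblem_pathEval hQ.generator).map_eq_of_isLinearFlow hA hm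
    (h₀ ▸ hQ.initial) t

end IsMarkovPathLaw

end PathLaw

section WaitingTime

theorem integral_setIntegral_Ioc {P : Measure ℝ} [IsFiniteMeasure P] {g : ℝ → ℝ}
    (hg : Measurable g) (hi : IntegrableOn (fun v => P.real (Set.Ici v) * g v) (Set.Ioi 0)) :
    ∫ e, (∫ v in Set.Ioc 0 e, g v) ∂P = ∫ v in Set.Ioi 0, P.real (Set.Ici v) * g v := by
  have section_integral (v c : ℝ) :
      ∫ e, (Set.Ici v).indicator (fun _ => c) e ∂P = P.real (Set.Ici v) * c := by
    rw [integral_indicator_const _ measurableSet_Ici, smul_eq_mul]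
  have measurable_tail : Measurable fun p : ℝ × ℝ => (Set.Ici p.1).indicator (fun _ => g p.1) p.2 :=
    (hg.comp measurable_fst).indicator
      (measurableSet_le measurable_fst measurable_snd : MeasurableSet {p : ℝ × ℝ | p.1 ≤ p.2})
  have integrable_tail :
      Integrable (fun p : ℝ × ℝ => (Set.Ici p.1).indicator (fun _ => g p.1) p.2)
        ((volume.restrict (Set.Ioi 0)).prod P) := by
    refine (integrable_prod_iff measurable_tail.aestronglyMeasurable).2
      ⟨Eventually.of_forall fun v => (integrable_const (g v)).indicator measurableSet_Ici, ?_⟩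
    refine hi.norm.congr (Eventually.of_forall fun v => ?_)
    simp only [norm_indicator_eq_indicator_norm, section_integral, norm_mul,
      Real.norm_of_nonneg measureReal_nonneg]
  have swap := integral_integral_swap
    (f := fun v e => (Set.Ici v).indicator (fun _ => g v) e) integrable_tail
  simp only [section_integral] at swap
  rw [swap]
  refine integral_congr_ae (Eventually.of_forall fun e => ?_)
  simp only [← integral_indicator measurableSet_Ioc, ← integral_indicator measurableSet_Ioi]
  refine integral_congr_ae (Eventually.of_forall fun v => ?_)
  by_cases h₁ : 0 < v <;> by_cases h₂ : v ≤ e <;> simp [h₁, h₂]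

variable {r : ℝ}

theorem integral_expMeasure (hr : 0 ≤ r) (f : ℝ → ℝ) :
    ∫ e, f e ∂(expMeasure r) = ∫ e in Set.Ioi 0, r * Real.exp (-(r * e)) * f e := by
  change ∫ e, f e ∂(volume.withDensity (exponentialPDF r)) = _
  rw [integral_withDensity_eq_integral_toReal_smul
    (show Measurable (exponentialPDF r) from (measurable_exponentialPDFReal r).ennreal_ofReal)
    (Eventually.of_forall fun _ => ENNReal.ofReal_lt_top), ← integral_Ici_eq_integral_Ioi,
    ← integral_indicator measurableSet_Ici]
  refine integral_congr_ae (Eventually.of_forall fun e => ?_)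
  rcases le_or_gt 0 e with he | he
  · simp only [Set.indicator_of_mem (Set.mem_Ici.2 he), exponentialPDF_of_nonneg he,
      ENNReal.toReal_ofReal (mul_nonneg hr (Real.exp_pos _).le), smul_eq_mul]
  · simp [Set.indicator_of_notMem (Set.notMem_Ici.2 he), exponentialPDF_of_neg he]

theorem expMeasure_real_Ici (hr : 0 < r) {v : ℝ} (hv : 0 ≤ v) :
    (expMeasure r).real (Set.Ici v) = Real.exp (-(r * v)) := by
  have := isProbabilityMeasure_expMeasure hr
  have atomless : expMeasure r ≪ volume := withDensity_absolutelyContinuous _ _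
  have tail := probReal_add_probReal_compl (μ := expMeasure r) (measurableSet_Iic (a := v))
  rw [Set.compl_Iic, measureReal_congr (atomless.ae_eq Ioi_ae_eq_Ici), ← cdf_eq_real,
    cdf_expMeasure_eq hr, if_pos hv] at tail
  linarith

/-- The exponential law of rate `r`, carried by `ℝ≥0`: the law of the time between two
consecutive jumps. -/
def waitingLaw (r : ℝ) : Measure ℝ≥0 := (expMeasure r).map Real.toNNReal

theorem isProbabilityMeasure_waitingLaw (hr : 0 < r) : IsProbabilityMeasure (waitingLaw r) :=
  have := isProbabilityMeasure_expMeasure hr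
  Measure.isProbabilityMeasure_map measurable_real_toNNReal.aemeasurable

theorem mul_integral_waitingLaw_integral (hr : 0 < r) {g : ℝ≥0 → ℝ} {C : ℝ}
    (hg : BoundedBy g C) :
    r * ∫ e, (∫ v in (0 : ℝ)..e, g v.toNNReal) ∂(waitingLaw r) = ∫ e, g e ∂(waitingLaw r) := by
  have := isProbabilityMeasure_expMeasure hr
  have hg' : BoundedBy (fun v : ℝ => g v.toNNReal) C := hg.comp measurable_real_toNNReal
  have tail (v : ℝ) (hv : v ∈ Set.Ioi 0) : (expMeasure r).real (Set.Ici v) * g v.toNNReal =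
      Real.exp (-(r * v)) * g v.toNNReal := by rw [expMeasure_real_Ici hr (le_of_lt hv)]
  have integrable_exp : IntegrableOn (fun v => Real.exp (-(r * v)) * g v.toNNReal) (Set.Ioi 0) := by
    refine (Integrable.bdd_mul (c := C) ?_ hg'.measurable.aestronglyMeasurable
      (Eventually.of_forall hg'.abs_le)).congr (Eventually.of_forall fun v => mul_comm _ _)
    simpa [IntegrableOn] using exp_neg_integrableOn_Ioi 0 hr
  have truncate (e : ℝ) : ∫ v in (0 : ℝ)..(e.toNNReal : ℝ), g v.toNNReal =
      ∫ v in Set.Ioc 0 e, g v.toNNReal := by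
    rw [intervalIntegral.integral_of_le e.toNNReal.coe_nonneg, Real.coe_toNNReal']
    congr 2
    ext v
    simp only [Set.mem_Ioc, le_max_iff]
    grind
  have measurable_integral : Measurable fun e : ℝ≥0 => ∫ v in (0 : ℝ)..e, g v.toNNReal :=
    (intervalIntegral.continuous_primitive hg'.intervalIntegrable 0).measurable.comp
      measurable_coe_nnreal_real
  rw [waitingLaw, integral_map measurable_real_toNNReal.aemeasurable
    measurable_integral.aestronglyMeasurable, integral_map measurable_real_toNNReal.aemeasurable
    hg.measurable.aestronglyMeasurable]
  simp only [truncate]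
  rw [integral_setIntegral_Ioc hg'.measurable
      (integrable_exp.congr_fun (fun v hv => (tail v hv).symm) measurableSet_Ioi),
    setIntegral_congr_fun measurableSet_Ioi tail, integral_expMeasure hr.le, ← integral_const_mul]
  simp only [mul_assoc]

theorem ae_pos_waitingLaw (hr : 0 < r) : ∀ᵐ e ∂(waitingLaw r), 0 < e := by
  have := isProbabilityMeasure_waitingLaw hr
  have key := mul_integral_waitingLaw_integral hr
    (boundedBy_indicator_one (measurableSet_singleton (0 : ℝ≥0)))
  have primitive_zero (e : ℝ≥0) :
      ∫ v in (0 : ℝ)..e, ({0} : Set ℝ≥0).indicator (1 : ℝ≥0 → ℝ) v.toNNReal = 0 := by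
    refine intervalIntegral.integral_zero_ae (Eventually.of_forall fun v hv => ?_)
    rw [Set.uIoc_of_le e.coe_nonneg] at hv
    simp [hv.1]
  simp only [primitive_zero, integral_zero, mul_zero] at key
  rw [integral_indicator_one (measurableSet_singleton _), eq_comm, measureReal_eq_zero_iff] at key
  rw [ae_iff]
  simpa using key

theorem integral_exp_neg_waitingLaw_lt_one (hr : 0 < r) :
    ∫ e : ℝ≥0, Real.exp (-(e : ℝ)) ∂(waitingLaw r) < 1 := by
  have := isProbabilityMeasure_waitingLaw hr
  have bounded : BoundedBy (fun e : ℝ≥0 => Real.exp (-(e : ℝ))) 1 :=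
    ⟨by fun_prop, fun e => by simp⟩
  have primitive (e : ℝ≥0) :
      ∫ v in (0 : ℝ)..e, Real.exp (-(v.toNNReal : ℝ)) = 1 - Real.exp (-(e : ℝ)) := by
    have : Set.EqOn (fun v : ℝ => Real.exp (-(v.toNNReal : ℝ))) (fun v => Real.exp (-v))
        (Set.uIcc 0 e) := fun v hv => by
      rw [Set.uIcc_of_le e.coe_nonneg] at hv
      simp only [Real.coe_toNNReal v hv.1]
    rw [intervalIntegral.integral_congr this, intervalIntegral.integral_comp_neg]
    simp
  have key := mul_integral_waitingLaw_integral hr bounded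
  simp only [primitive] at key
  rw [integral_sub (integrable_const 1) (bounded.integrable _)] at key
  simp only [integral_const, probReal_univ, smul_eq_mul, mul_one] at key
  nlinarith

end WaitingTime

section ResampleOneFactor

variable {ι : Type*} [DecidableEq ι] {X : ι → Type*} [∀ i, MeasurableSpace (X i)]
  (μ : ∀ i, Measure (X i)) [∀ i, IsProbabilityMeasure (μ i)] (i : ι)

theorem map_update_infinitePi :
    ((Measure.infinitePi μ).prod (μ i)).map (fun p => Function.update p.1 i p.2) =
      Measure.infinitePi μ := by
  refine Measure.eq_infinitePi μ fun s t ht => ?_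
  have preimage : (fun p : (∀ j, X j) × X i => Function.update p.1 i p.2) ⁻¹' (s : Set ι).pi t =
      ((s.erase i : Finset ι) : Set ι).pi t ×ˢ {a | i ∈ s → a ∈ t i} := by
    ext p
    simp only [Set.mem_preimage, Set.update_mem_pi_iff, Finset.coe_erase, Set.mem_prod,
      Set.mem_ofPred_eq, Finset.mem_coe]
  rw [Measure.map_apply measurable_update' (.pi s.countable_toSet fun j _ => ht j), preimage,
    Measure.prod_prod, Measure.infinitePi_pi _ fun j _ => ht j]
  by_cases hi : i ∈ s
  · simp only [hi, forall_const, Set.ofPred_mem_eq, Finset.prod_erase_mul _ _ hi]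
  · simp [hi]

theorem integral_infinitePi_eq_integral_update {F : (∀ i, X i) → ℝ} {C : ℝ}
    (hF : BoundedBy F C) :
    ∫ ω, F ω ∂(Measure.infinitePi μ) =
      ∫ ω, ∫ e, F (Function.update ω i e) ∂(μ i) ∂(Measure.infinitePi μ) := by
  conv_lhs => rw [← map_update_infinitePi μ i]
  rw [integral_map measurable_update'.aemeasurable hF.measurable.aestronglyMeasurable,
    integral_prod (fun p => F (Function.update p.1 i p.2))
      ((hF.comp (measurable_update' (a := i))).integrable _)]

end ResampleOneFactor

section Cadlag

variable {S : Type*} [TopologicalSpace S]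

theorem isCadlag_const (z : S) : IsCadlag fun _ : ℝ≥0 => z :=
  fun _ => ⟨continuousWithinAt_const, z, tendsto_const_nhds⟩

theorem IsCadlag.ite {x : ℝ≥0 → S} (hx : IsCadlag x) (T : ℝ≥0) (z : S) :
    IsCadlag fun t => if T ≤ t then z else x t := by
  refine fun t => ⟨?_, ?_⟩
  · by_cases h : T ≤ t
    · exact (continuousWithinAt_const (b := z)).congr (fun u hu => if_pos (h.trans hu)) (if_pos h)
    · refine (hx t).1.congr_of_eventuallyEq ?_ (if_neg h)
      filter_upwards [mem_nhdsWithin_of_mem_nhds (Iio_mem_nhds (not_le.1 h))] with u hu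
      exact if_neg (not_le.2 hu)
  · by_cases h : T < t
    · refine ⟨z, tendsto_const_nhds.congr' ?_⟩
      filter_upwards [mem_nhdsWithin_of_mem_nhds (Ioi_mem_nhds h)] with u hu
      exact (if_pos (le_of_lt hu)).symm
    · obtain ⟨y, hy⟩ := (hx t).2
      refine ⟨y, hy.congr' ?_⟩
      filter_upwards [self_mem_nhdsWithin] with u hu
      exact (if_neg (not_le.2 (lt_of_lt_of_le hu (not_lt.1 h)))).symm

theorem isCadlag_of_locally_eq {x : ℝ≥0 → S}
    (h : ∀ t, ∃ y, IsCadlag y ∧ ∃ T, t < T ∧ ∀ u < T, x u = y u) : IsCadlag x := by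
  intro t
  obtain ⟨y, hy, T, hT, heq⟩ := h t
  have eventuallyEq (s : Set ℝ≥0) : x =ᶠ[𝓝[s] t] y := by
    filter_upwards [mem_nhdsWithin_of_mem_nhds (Iio_mem_nhds hT)] with u hu
    exact heq u hu
  obtain ⟨z, hz⟩ := (hy t).2
  exact ⟨(hy t).1.congr_of_eventuallyEq (eventuallyEq _) (heq t hT),
    z, hz.congr' (eventuallyEq _).symm⟩

end Cadlag

section JumpProcess

variable {S E : Type*}

/-- The randomness that drives a jump process: `(ω n).1` is the waiting time before the `n`-th jump
and `(ω n).2` the mark used at that jump. The mark `(ω 0).2` chooses the initial state, and the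
time `(ω 0).1` is ignored. -/
abbrev Noise (E : Type*) : Type _ := ℕ → ℝ≥0 × E

/-- The time of the `n`-th jump. -/
def jumpTime (ω : Noise E) (n : ℕ) : ℝ≥0 := ∑ i ∈ Finset.range n, (ω (i + 1)).1

/-- The jump times do not accumulate. -/
def NonExplosive (ω : Noise E) : Prop := Tendsto (jumpTime ω) atTop atTop

theorem jumpTime_succ (ω : Noise E) (n : ℕ) :
    jumpTime ω (n + 1) = jumpTime ω n + (ω (n + 1)).1 := Finset.sum_range_succ _ _

theorem jumpTime_mono (ω : Noise E) : Monotone (jumpTime ω) :=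
  monotone_nat_of_le_succ fun n => (jumpTime_succ ω n).symm ▸ le_self_add

theorem jumpTime_update {n k : ℕ} (hk : k ≤ n) (ω : Noise E) (e : ℝ≥0 × E) :
    jumpTime (Function.update ω (n + 1) e) k = jumpTime ω k :=
  Finset.sum_congr rfl fun i hi => by
    rw [Function.update_of_ne (by have := Finset.mem_range.1 hi; omega)]

theorem measurable_jumpTime [MeasurableSpace E] (n : ℕ) :
    Measurable fun ω : Noise E => jumpTime ω n :=
  Finset.measurable_sum _ fun i _ => measurable_fst.comp (measurable_pi_apply (i + 1))

theorem measurableSet_nonExplosive [MeasurableSpace E] :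
    MeasurableSet {ω : Noise E | NonExplosive ω} :=
  measurableSet_tendsto atTop measurable_jumpTime

theorem NonExplosive.exists_lt {ω : Noise E} (hω : NonExplosive ω) (t : ℝ≥0) :
    ∃ n, t < jumpTime ω (n + 1) :=
  ((hω.comp (tendsto_add_atTop_nat 1)).eventually_gt_atTop t).exists

/-- The recipe of a jump process: it starts from `init u`, where `u` is its first mark, and a jump
at time `t` from `z` with mark `u` leads to `move t z u`. -/
structure JumpScheme (S E : Type*) [MeasurableSpace S] [MeasurableSpace E] where
  init : E → S
  move : ℝ≥0 → S → E → S
  measurable_init : Measurable init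
  measurable_move : Measurable fun p : ℝ≥0 × S × E => move p.1 p.2.1 p.2.2

namespace JumpScheme

variable [MeasurableSpace S] [MeasurableSpace E] (J : JumpScheme S E)

/-- The state after the `n`-th jump. -/
def state (ω : Noise E) : ℕ → S
  | 0 => J.init (ω 0).2
  | n + 1 => J.move (jumpTime ω (n + 1)) (state ω n) (ω (n + 1)).2

theorem state_update {n k : ℕ} (hk : k ≤ n) (ω : Noise E) (e : ℝ≥0 × E) :
    J.state (Function.update ω (n + 1) e) k = J.state ω k := by
  induction k with
  | zero => rw [state, state, Function.update_of_ne (by omega)]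
  | succ k ih =>
    rw [state, state, ih (by omega), Function.update_of_ne (by omega), jumpTime_update hk]

theorem measurable_state (n : ℕ) : Measurable fun ω => J.state ω n := by
  induction n with
  | zero => exact J.measurable_init.comp (measurable_snd.comp (measurable_pi_apply 0))
  | succ n ih =>
    exact J.measurable_move.comp ((measurable_jumpTime (n + 1)).prodMk
      (ih.prodMk (measurable_snd.comp (measurable_pi_apply (n + 1)))))

variable [TopologicalSpace S]

/-- The path in which only the first `n` jumps are performed. -/
def pathUpTo (ω : Noise E) : ℕ → SkorokhodSpace S
  | 0 => ⟨fun _ => J.state ω 0, isCadlag_const _⟩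
  | n + 1 => ⟨fun t => if jumpTime ω (n + 1) ≤ t then J.state ω (n + 1) else
      pathEval t (pathUpTo ω n), (pathUpTo ω n).2.ite _ _⟩

theorem pathEval_pathUpTo_succ (ω : Noise E) (n : ℕ) (t : ℝ≥0) :
    pathEval t (J.pathUpTo ω (n + 1)) = if jumpTime ω (n + 1) ≤ t then J.state ω (n + 1) else
      pathEval t (J.pathUpTo ω n) := rfl

theorem pathEval_pathUpTo_of_le {ω : Noise E} {n : ℕ} {t : ℝ≥0} (h : jumpTime ω n ≤ t) :
    pathEval t (J.pathUpTo ω n) = J.state ω n := by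
  cases n with
  | zero => rfl
  | succ n => exact if_pos h

theorem pathEval_pathUpTo_of_lt {ω : Noise E} {n k : ℕ} (hnk : n ≤ k) {t : ℝ≥0}
    (h : t < jumpTime ω (n + 1)) :
    pathEval t (J.pathUpTo ω k) = pathEval t (J.pathUpTo ω n) := by
  induction k, hnk using Nat.le_induction with
  | base => rfl
  | succ k hk ih =>
    rw [pathEval_pathUpTo_succ, if_neg (not_le.2 (h.trans_le (jumpTime_mono ω (by omega)))), ih]

theorem pathUpTo_update {n k : ℕ} (hk : k ≤ n) (ω : Noise E) (e : ℝ≥0 × E) :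
    J.pathUpTo (Function.update ω (n + 1) e) k = J.pathUpTo ω k := by
  induction k with
  | zero => simp only [pathUpTo, J.state_update hk]
  | succ k ih =>
    simp only [pathUpTo, ih (by omega), J.state_update hk, jumpTime_update hk]

theorem measurable_pathUpTo (n : ℕ) : Measurable fun ω => J.pathUpTo ω n := by
  refine Measurable.subtype_mk (measurable_pi_iff.2 fun t => ?_)
  induction n with
  | zero => exact J.measurable_state 0
  | succ n ih =>
    exact Measurable.ite (measurableSet_le (measurable_jumpTime _) measurable_const)
      (J.measurable_state (n + 1)) ih

theorem exists_pathEval_eq {ω : Noise E} (hω : NonExplosive ω) :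
    ∃ x : SkorokhodSpace S, ∀ n t, t < jumpTime ω (n + 1) →
      pathEval t x = pathEval t (J.pathUpTo ω n) := by
  choose N hN using hω.exists_lt
  have value_eq (n : ℕ) (t : ℝ≥0) (ht : t < jumpTime ω (n + 1)) :
      pathEval t (J.pathUpTo ω (N t)) = pathEval t (J.pathUpTo ω n) := by
    rcases le_total (N t) n with h | h
    · exact (J.pathEval_pathUpTo_of_lt h (hN t)).symm
    · exact J.pathEval_pathUpTo_of_lt h ht
  exact ⟨⟨fun t => pathEval t (J.pathUpTo ω (N t)), isCadlag_of_locally_eq fun t =>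
    ⟨_, (J.pathUpTo ω (N t)).2, _, hN t, value_eq (N t)⟩⟩, value_eq⟩

open scoped Classical in
/-- The path of the jump process; noises with accumulating jump times get the constant path. -/
def path (ω : Noise E) : SkorokhodSpace S :=
  if hω : NonExplosive ω then (J.exists_pathEval_eq hω).choose else J.pathUpTo ω 0

theorem pathEval_path {ω : Noise E} (hω : NonExplosive ω) {n : ℕ} {t : ℝ≥0}
    (ht : t < jumpTime ω (n + 1)) : pathEval t (J.path ω) = pathEval t (J.pathUpTo ω n) := by
  rw [path, dif_pos hω]
  exact (J.exists_pathEval_eq hω).choose_spec n t ht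

theorem measurable_path [PolishSpace S] [BorelSpace S] : Measurable J.path := by
  classical
  suffices measurable_eval : ∀ t, Measurable fun ω => pathEval t (J.path ω) from
    Measurable.subtype_mk (h := fun ω => (J.path ω).2) (measurable_pi_iff.2 measurable_eval)
  intro t
  have measurable_approx (n : ℕ) : Measurable fun ω : Noise E =>
      pathEval t (if NonExplosive ω then J.pathUpTo ω n else J.pathUpTo ω 0) :=
    (measurable_pathEval t).comp
      ((J.measurable_pathUpTo n).ite measurableSet_nonExplosive (J.measurable_pathUpTo 0))
  refine measurable_of_tendsto_metrizable measurable_approx (tendsto_pi_nhds.2 fun ω => ?_)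
  by_cases hω : NonExplosive ω
  · obtain ⟨N, hN⟩ := hω.exists_lt t
    refine tendsto_atTop_of_eventually_const (i₀ := N) fun n hn => ?_
    rw [if_pos hω, J.pathEval_pathUpTo_of_lt hn hN]
    exact (J.pathEval_path hω hN).symm
  · have path_eq : J.path ω = J.pathUpTo ω 0 := dif_neg hω
    simp only [if_neg hω, ← path_eq]
    exact tendsto_const_nhds

end JumpScheme

section NoiseLaw

variable [MeasurableSpace E] (r : ℝ) (ν : Measure E)

/-- The law of the noise: independent waiting times of rate `r` and independent marks of law `ν`. -/
def noiseLaw : Measure (Noise E) := Measure.infinitePi fun _ => (waitingLaw r).prod ν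

variable [hr : Fact (0 < r)] [IsProbabilityMeasure ν]

instance : IsProbabilityMeasure (waitingLaw r) := isProbabilityMeasure_waitingLaw hr.out

instance : IsProbabilityMeasure (noiseLaw r ν) := by
  unfold noiseLaw
  infer_instance

theorem integral_exp_neg_jumpTime (n : ℕ) :
    ∫ ω, Real.exp (-(jumpTime ω n : ℝ)) ∂(noiseLaw r ν) =
      (∫ e : ℝ≥0, Real.exp (-(e : ℝ)) ∂(waitingLaw r)) ^ n := by
  induction n with
  | zero => simp [jumpTime]
  | succ n ih =>
    have bounded : BoundedBy (fun ω : Noise E => Real.exp (-(jumpTime ω (n + 1) : ℝ))) 1 :=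
      ⟨Real.measurable_exp.comp (measurable_jumpTime (n + 1)).coe_nnreal_real.neg, fun ω => by simp⟩
    rw [noiseLaw, integral_infinitePi_eq_integral_update _ (n + 1) bounded, ← noiseLaw, pow_succ,
      ← ih, ← integral_mul_const]
    congr 1 with ω
    simp only [jumpTime_succ, jumpTime_update le_rfl, Function.update_self, NNReal.coe_add,
      neg_add, Real.exp_add, integral_const_mul]
    rw [integral_fun_fst (f := fun e : ℝ≥0 => Real.exp (-(e : ℝ)))]
    simp

theorem ae_nonExplosive : ∀ᵐ ω ∂(noiseLaw r ν), NonExplosive ω := by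
  have bounded (n : ℕ) : BoundedBy (fun ω : Noise E => Real.exp (-(jumpTime ω n : ℝ))) 1 :=
    ⟨Real.measurable_exp.comp (measurable_jumpTime n).coe_nnreal_real.neg, fun ω => by simp⟩
  have integral_tendsto : Tendsto (fun n => ∫ ω, Real.exp (-(jumpTime ω n : ℝ)) ∂(noiseLaw r ν))
      atTop (𝓝 (∫ _, (0 : ℝ) ∂(noiseLaw r ν))) := by
    simp only [integral_exp_neg_jumpTime, integral_zero]
    exact tendsto_pow_atTop_nhds_zero_of_lt_one
      (integral_nonneg fun e => (Real.exp_pos _).le) (integral_exp_neg_waitingLaw_lt_one hr.out)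
  have ae_tendsto := tendsto_of_integral_tendsto_of_antitone
    (F := fun _ => 0) (fun n => (bounded n).integrable (noiseLaw r ν))
    (integrable_const 0) integral_tendsto
    (Eventually.of_forall fun ω m n hmn => Real.exp_le_exp.2
      (neg_le_neg (NNReal.coe_le_coe.2 (jumpTime_mono ω hmn))))
    (Eventually.of_forall fun ω n => (Real.exp_pos _).le)
  filter_upwards [ae_tendsto] with ω hω
  rw [Real.tendsto_exp_comp_nhds_zero, tendsto_neg_atBot_iff] at hω
  exact NNReal.tendsto_coe_atTop.1 hω

end NoiseLaw

end JumpProcess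

theorem integral_indicator_Ico_comm {f : ℝ → ℝ} {a b c d : ℝ} (hab : a ≤ b) (hcd : c ≤ d) :
    ∫ v in a..b, (Set.Ico c d).indicator f v = ∫ v in c..d, (Set.Ioc a b).indicator f v := by
  rw [intervalIntegral.integral_of_le hab, intervalIntegral.integral_of_le hcd,
    ← integral_Ico_eq_integral_Ioc (x := c), setIntegral_indicator measurableSet_Ico,
    setIntegral_indicator measurableSet_Ioc, Set.inter_comm]

theorem indicator_Ioc_toNNReal (f : ℝ≥0 → ℝ) (s t : ℝ≥0) (v : ℝ) :
    (Set.Ioc s t).indicator f v.toNNReal =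
      (Set.Ioc (s : ℝ) t).indicator (fun v => f v.toNNReal) v := by
  simp only [Set.indicator_apply, Set.mem_Ioc, Real.lt_toNNReal_iff_coe_lt,
    Real.toNNReal_le_iff_le_coe]

theorem BoundedBy.intervalIntegral {Ω : Type*} [MeasurableSpace Ω] {f : ℝ × Ω → ℝ} {C a b : ℝ}
    (hf : BoundedBy f C) (hab : a ≤ b) :
    BoundedBy (fun ω => ∫ v in a..b, f (v, ω)) (C * (b - a)) := by
  refine ⟨?_, fun ω => ?_⟩
  · simp only [intervalIntegral.integral_of_le hab]
    exact hf.measurable.stronglyMeasurable.integral_prod_left'.measurable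
  · rw [← Real.norm_eq_abs, ← abs_of_nonneg (sub_nonneg.2 hab)]
    exact intervalIntegral.norm_integral_le_of_norm_le_const fun v _ => hf.abs_le (v, ω)

namespace JumpScheme

section StoppedIncrement

variable {S E : Type*} [TopologicalSpace S] [MeasurableSpace S] [MeasurableSpace E]
  (J : JumpScheme S E) {A : ℝ≥0 → (S → ℝ) → S → ℝ} {h : S → ℝ} {l C : ℝ} {s t : ℝ≥0}

/-- The rate `A v h` along the path, cut off at the `n`-th jump. -/
def stoppedRate (A : ℝ≥0 → (S → ℝ) → S → ℝ) (h : S → ℝ) (n : ℕ) (ω : Noise E) : ℝ → ℝ :=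
  (Set.Iio (jumpTime ω n : ℝ)).indicator
    fun v => A v.toNNReal h (pathEval v.toNNReal (J.pathUpTo ω n))

/-- The part of the time integral of `A v h` over `(s, t]` that is due to staying in the state `z`
during the time interval from `a` to `b`. -/
def compensator (A : ℝ≥0 → (S → ℝ) → S → ℝ) (h : S → ℝ) (s t : ℝ≥0) (z : S) (a b : ℝ≥0) : ℝ :=
  ∫ v in (a : ℝ)..b, (Set.Ioc s t).indicator (fun v => A v h z) v.toNNReal

/-- The increment over `(s, t]` of the process `dynkin A` stopped at the `n`-th jump. -/
def stoppedIncrement (A : ℝ≥0 → (S → ℝ) → S → ℝ) (h : S → ℝ) (s t : ℝ≥0) (n : ℕ)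
    (ω : Noise E) : ℝ :=
  h (pathEval t (J.pathUpTo ω n)) - h (pathEval s (J.pathUpTo ω n)) -
    ∫ v in (s : ℝ)..t, J.stoppedRate A h n ω v

theorem stoppedIncrement_zero (ω : Noise E) : J.stoppedIncrement A h s t 0 ω = 0 := by
  have integral_eq_zero : ∫ v in (s : ℝ)..t, J.stoppedRate A h 0 ω v = 0 := by
    refine intervalIntegral.integral_zero_ae (Eventually.of_forall fun v hv => ?_)
    have v_pos : 0 < v := (le_min s.coe_nonneg t.coe_nonneg).trans_lt hv.1
    simp [stoppedRate, jumpTime, v_pos.le]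
  rw [stoppedIncrement, integral_eq_zero, sub_zero, J.pathEval_pathUpTo_of_le (by simp [jumpTime]),
    J.pathEval_pathUpTo_of_le (by simp [jumpTime]), sub_self]

theorem stoppedRate_succ (n : ℕ) (ω : Noise E) {v : ℝ} (hv : 0 ≤ v) :
    J.stoppedRate A h (n + 1) ω v = J.stoppedRate A h n ω v +
      (Set.Ico (jumpTime ω n : ℝ) (jumpTime ω (n + 1))).indicator
        (fun v => A v.toNNReal h (J.state ω n)) v := by
  have le_succ : (jumpTime ω n : ℝ) ≤ jumpTime ω (n + 1) := jumpTime_mono ω n.le_succ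
  by_cases before_succ : v < jumpTime ω (n + 1)
  · rw [stoppedRate, Set.indicator_of_mem (Set.mem_Iio.2 before_succ),
      J.pathEval_pathUpTo_of_lt n.le_succ ((Real.toNNReal_lt_iff_lt_coe hv).2 before_succ)]
    rcases lt_or_ge v (jumpTime ω n) with h' | h'
    · simp [stoppedRate, h']
    · rw [J.pathEval_pathUpTo_of_le (NNReal.le_toNNReal_of_coe_le h')]
      simp [stoppedRate, h', before_succ]
  · have h' := not_lt.1 before_succ
    simp [stoppedRate, h', le_succ.trans h']

variable [PolishSpace S] [BorelSpace S]

theorem boundedBy_stoppedRate (hA : IsBoundedRate A l) (hh : BoundedBy h C) (n : ℕ) :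
    BoundedBy (fun p : ℝ × Noise E => J.stoppedRate A h n p.2 p.1) (l * C) :=
  (hA.boundedBy_path (X := fun t ω => pathEval t (J.pathUpTo ω n))
    (measurable_uncurry_pathEval.comp
      (measurable_fst.prodMk ((J.measurable_pathUpTo n).comp measurable_snd))) hh).indicator
    (measurableSet_lt measurable_fst
      ((measurable_jumpTime n).coe_nnreal_real.comp measurable_snd))

theorem boundedBy_stoppedIncrement (hA : IsBoundedRate A l) (hh : BoundedBy h C) (hst : s ≤ t)
    (n : ℕ) : BoundedBy (J.stoppedIncrement A h s t n) (C + C + l * C * (t - s)) := by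
  have bounded_eval (u : ℝ≥0) : BoundedBy (fun ω => h (pathEval u (J.pathUpTo ω n))) C :=
    hh.comp ((measurable_pathEval u).comp (J.measurable_pathUpTo n))
  exact ((bounded_eval t).sub (bounded_eval s)).sub
    ((J.boundedBy_stoppedRate hA hh n).intervalIntegral (NNReal.coe_le_coe.2 hst))

theorem stoppedIncrement_eq_dynkin_sub (hA : IsBoundedRate A l) (hh : BoundedBy h C) (hst : s ≤ t)
    {ω : Noise E} (hω : NonExplosive ω) {n : ℕ} (ht : t < jumpTime ω n) :
    J.stoppedIncrement A h s t n ω =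
      dynkin A pathEval h t (J.path ω) - dynkin A pathEval h s (J.path ω) := by
  have path_eq {u : ℝ≥0} (hu : u ≤ t) : pathEval u (J.pathUpTo ω n) = pathEval u (J.path ω) :=
    (J.pathEval_path hω ((hu.trans_lt ht).trans_le (jumpTime_mono ω n.le_succ))).symm
  rw [dynkin_sub hA measurable_uncurry_pathEval hh, stoppedIncrement, path_eq le_rfl, path_eq hst]
  congr 1
  refine intervalIntegral.integral_congr fun v hv => ?_
  rw [Set.uIcc_of_le (NNReal.coe_le_coe.2 hst)] at hv
  rw [stoppedRate, Set.indicator_of_mem (Set.mem_Iio.2 (hv.2.trans_lt (NNReal.coe_lt_coe.2 ht))),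
    path_eq (Real.toNNReal_le_iff_le_coe.2 hv.2)]

theorem integral_stoppedRate_succ (hA : IsBoundedRate A l) (hh : BoundedBy h C) (hst : s ≤ t)
    (n : ℕ) (ω : Noise E) :
    ∫ v in (s : ℝ)..t, J.stoppedRate A h (n + 1) ω v =
      (∫ v in (s : ℝ)..t, J.stoppedRate A h n ω v) +
        compensator A h s t (J.state ω n) (jumpTime ω n) (jumpTime ω (n + 1)) := by
  have rate : BoundedBy (fun v : ℝ => A v.toNNReal h (J.state ω n)) (l * C) :=
    (hA h C hh).comp (f := fun v : ℝ => (v.toNNReal, J.state ω n)) (by fun_prop)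
  simp only [compensator, indicator_Ioc_toNNReal]
  rw [← integral_indicator_Ico_comm (NNReal.coe_le_coe.2 hst)
    (NNReal.coe_le_coe.2 (jumpTime_mono ω n.le_succ)), ← intervalIntegral.integral_add]
  · refine intervalIntegral.integral_congr fun v hv => ?_
    rw [Set.uIcc_of_le (NNReal.coe_le_coe.2 hst)] at hv
    exact J.stoppedRate_succ n ω (s.coe_nonneg.trans hv.1)
  · exact ((J.boundedBy_stoppedRate hA hh n).comp
      (measurable_prodMk_right (y := ω))).intervalIntegrable _ _
  · exact (rate.indicator measurableSet_Ico).intervalIntegrable _ _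

theorem stoppedIncrement_succ (hA : IsBoundedRate A l) (hh : BoundedBy h C) (hst : s ≤ t) (n : ℕ)
    (ω : Noise E) :
    J.stoppedIncrement A h s t (n + 1) ω = J.stoppedIncrement A h s t n ω +
      ((Set.Ioc s t).indicator (fun _ => h (J.state ω (n + 1)) - h (J.state ω n))
          (jumpTime ω (n + 1)) -
        compensator A h s t (J.state ω n) (jumpTime ω n) (jumpTime ω (n + 1))) := by
  have eval_succ (u : ℝ≥0) : h (pathEval u (J.pathUpTo ω (n + 1))) =
      h (pathEval u (J.pathUpTo ω n)) + (Set.Iic u).indicator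
        (fun _ => h (J.state ω (n + 1)) - h (J.state ω n)) (jumpTime ω (n + 1)) := by
    rw [pathEval_pathUpTo_succ]
    split_ifs with hu
    · rw [J.pathEval_pathUpTo_of_le ((jumpTime_mono ω n.le_succ).trans hu),
        Set.indicator_of_mem (Set.mem_Iic.2 hu)]
      ring
    · rw [Set.indicator_of_notMem (by simpa using hu), add_zero]
  have indicator_Ioc := congrFun (Set.indicator_sdiff (Set.Iic_subset_Iic.2 hst)
    fun _ => h (J.state ω (n + 1)) - h (J.state ω n)) (jumpTime ω (n + 1))
  rw [Set.Iic_sdiff_Iic, Pi.sub_apply] at indicator_Ioc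
  rw [stoppedIncrement, stoppedIncrement, J.integral_stoppedRate_succ hA hh hst, eval_succ,
    eval_succ, indicator_Ioc]
  ring

end StoppedIncrement

end JumpScheme

namespace JumpScheme

section Compensation

variable {S E : Type*} [MeasurableSpace S] [MeasurableSpace E] (J : JumpScheme S E) {r : ℝ}
  {ν : Measure E} {A : ℝ≥0 → (S → ℝ) → S → ℝ} {h : S → ℝ} {l C : ℝ}

/-- The jumps, performed at rate `r` with marks of law `ν`, have generator `A t` at time `t`. -/
def HasGenerator (r : ℝ) (ν : Measure E) (A : ℝ≥0 → (S → ℝ) → S → ℝ) : Prop :=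
  ∀ t h z, IsBoundedMeasurable h → A t h z = r * ∫ u, (h (J.move t z u) - h z) ∂ν

theorem compensator_eq_mul_integral (hJ : J.HasGenerator r ν A) (hh : BoundedBy h C)
    (s t τ e : ℝ≥0) (z : S) :
    compensator A h s t z τ (τ + e) =
      r * ∫ v in (0 : ℝ)..e, ∫ u, (Set.Ioc s t).indicator
        (fun _ => h (J.move (τ + v.toNNReal) z u) - h z) (τ + v.toNNReal) ∂ν := by
  have shift := intervalIntegral.integral_comp_add_left (a := 0) (b := e)
    (fun v : ℝ => (Set.Ioc s t).indicator (fun v => A v h z) v.toNNReal) τ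
  rw [add_zero] at shift
  rw [compensator, ← intervalIntegral.integral_const_mul, NNReal.coe_add, ← shift]
  refine intervalIntegral.integral_congr fun v hv => ?_
  rw [Set.uIcc_of_le e.coe_nonneg] at hv
  simp only [Real.toNNReal_add τ.coe_nonneg hv.1, Real.toNNReal_coe]
  by_cases hmem : τ + v.toNNReal ∈ Set.Ioc s t
  · simp only [Set.indicator_of_mem hmem, hJ _ h z hh.isBoundedMeasurable]
  · simp only [Set.indicator_of_notMem hmem, integral_zero, mul_zero]

theorem boundedBy_indicator_jump (hh : BoundedBy h C) (s t τ : ℝ≥0) (z : S) :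
    BoundedBy (fun e : ℝ≥0 × E => (Set.Ioc s t).indicator
      (fun _ => h (J.move (τ + e.1) z e.2) - h z) (τ + e.1)) (C + C) := by
  have target : Measurable fun e : ℝ≥0 × E => J.move (τ + e.1) z e.2 :=
    J.measurable_move.comp (f := fun e : ℝ≥0 × E => (τ + e.1, z, e.2)) (by fun_prop)
  have arrival : Measurable fun e : ℝ≥0 × E => τ + e.1 := by fun_prop
  exact ((hh.comp target).sub ⟨measurable_const, fun _ => hh.abs_le z⟩).indicator
    (arrival measurableSet_Ioc)

theorem boundedBy_compensator (hA : IsBoundedRate A l) (hh : BoundedBy h C) {s t : ℝ≥0}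
    (hst : s ≤ t) (τ : ℝ≥0) (z : S) :
    BoundedBy (fun e : ℝ≥0 => compensator A h s t z τ (τ + e)) (l * C * (t - s)) := by
  have rate : BoundedBy (fun v : ℝ => A v.toNNReal h z) (l * C) :=
    (hA h C hh).comp (f := fun v : ℝ => (v.toNNReal, z)) (by fun_prop)
  simp only [compensator, indicator_Ioc_toNNReal]
  refine ⟨?_, fun e => ?_⟩
  · exact (intervalIntegral.continuous_primitive
      (fun _ _ => (rate.indicator measurableSet_Ioc).intervalIntegrable _ _) τ).measurable.comp
      (g := fun b : ℝ => ∫ v in (τ : ℝ)..b, _)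
      (by fun_prop : Measurable fun e : ℝ≥0 => (τ + e : ℝ≥0).1)
  · rw [← integral_indicator_Ico_comm (NNReal.coe_le_coe.2 hst)
      (NNReal.coe_le_coe.2 (le_add_of_nonneg_right e.2)), ← Real.norm_eq_abs,
      ← abs_of_nonneg (sub_nonneg.2 (NNReal.coe_le_coe.2 hst))]
    exact intervalIntegral.norm_integral_le_of_norm_le_const
      fun v _ => (rate.indicator measurableSet_Ico).abs_le v

variable [hr : Fact (0 < r)] [IsProbabilityMeasure ν]

theorem integral_jump_sub_compensator (hJ : J.HasGenerator r ν A) (hA : IsBoundedRate A l)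
    (hh : BoundedBy h C) {s t : ℝ≥0} (hst : s ≤ t) (τ : ℝ≥0) (z : S) :
    ∫ e, ((Set.Ioc s t).indicator (fun _ => h (J.move (τ + e.1) z e.2) - h z) (τ + e.1) -
      compensator A h s t z τ (τ + e.1)) ∂((waitingLaw r).prod ν) = 0 := by
  have jump := J.boundedBy_indicator_jump hh s t τ z
  have compensator_bounded := boundedBy_compensator hA hh hst τ z
  rw [integral_sub (jump.integrable _) ((compensator_bounded.integrable _).comp_fst ν),
    integral_prod _ (jump.integrable _),
    integral_fun_fst (f := fun e : ℝ≥0 => compensator A h s t z τ (τ + e))]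
  simp only [J.compensator_eq_mul_integral hJ hh, integral_const_mul,
    mul_integral_waitingLaw_integral hr.out (jump.integral_prod_right ν), probReal_univ,
    one_smul, sub_self]

end Compensation

end JumpScheme

theorem mem_iff_of_pathEval_eq {S : Type*} [TopologicalSpace S] [MeasurableSpace S] [PolishSpace S]
    [BorelSpace S] {s : ℝ≥0} {B : Set (SkorokhodSpace S)} (hB : MeasurableSet[pathFiltration S s] B)
    {x y : SkorokhodSpace S} (hxy : ∀ u ≤ s, pathEval u x = pathEval u y) : x ∈ B ↔ y ∈ B := by
  have filtration_eq : pathFiltration S s =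
      MeasurableSpace.comap (fun x (u : Set.Iic s) => pathEval u.1 x) inferInstance :=
    Filtration.natural_eq_comap _ _ s
  rw [filtration_eq] at hB
  obtain ⟨B', -, rfl⟩ := hB
  have restrict_eq : (fun u : Set.Iic s => pathEval u.1 x) = fun u => pathEval u.1 y :=
    funext fun u => hxy u u.2
  simp only [Set.mem_preimage, restrict_eq]

theorem boundedBy_dynkin {S Ω : Type*} [MeasurableSpace S] [MeasurableSpace Ω]
    {A : ℝ≥0 → (S → ℝ) → S → ℝ} {X : ℝ≥0 → Ω → S} {h : S → ℝ} {l C : ℝ} (hA : IsBoundedRate A l)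
    (hX : Measurable fun p : ℝ≥0 × Ω => X p.1 p.2) (hh : BoundedBy h C) (t : ℝ≥0) :
    BoundedBy (dynkin A X h t) (C + C + l * C * (t - 0)) := by
  have bounded_value (u : ℝ≥0) : BoundedBy (fun ω => h (X u ω)) C :=
    hh.comp (hX.comp measurable_prodMk_left)
  exact ((bounded_value t).sub (bounded_value 0)).sub
    ((hA.boundedBy_path hX hh).intervalIntegral t.coe_nonneg)

namespace JumpScheme

section Law

variable {S E : Type*} [TopologicalSpace S] [MeasurableSpace S] [PolishSpace S] [BorelSpace S]
  [MeasurableSpace E] (J : JumpScheme S E) {r : ℝ} [hr : Fact (0 < r)] {ν : Measure E}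
  [IsProbabilityMeasure ν] {A : ℝ≥0 → (S → ℝ) → S → ℝ} {h : S → ℝ} {l C : ℝ} {s t : ℝ≥0}

theorem integral_stoppedIncrement_update (hJ : J.HasGenerator r ν A) (hA : IsBoundedRate A l)
    (hh : BoundedBy h C) (hst : s ≤ t) (n : ℕ) (ω : Noise E) :
    ∫ e, (J.stoppedIncrement A h s t (n + 1) (Function.update ω (n + 1) e) -
      J.stoppedIncrement A h s t n (Function.update ω (n + 1) e)) ∂((waitingLaw r).prod ν) = 0 := by
  simp only [J.stoppedIncrement_succ hA hh hst, add_sub_cancel_left, state, jumpTime_succ,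
    J.state_update le_rfl, jumpTime_update le_rfl, Function.update_self]
  exact J.integral_jump_sub_compensator hJ hA hh hst (jumpTime ω n) (J.state ω n)

theorem stoppedIncrement_succ_of_le (hA : IsBoundedRate A l) (hh : BoundedBy h C) (hst : s ≤ t)
    {n : ℕ} {ω : Noise E} (hn : jumpTime ω (n + 1) ≤ s) :
    J.stoppedIncrement A h s t (n + 1) ω = J.stoppedIncrement A h s t n ω := by
  have compensator_eq_zero :
      compensator A h s t (J.state ω n) (jumpTime ω n) (jumpTime ω (n + 1)) = 0 := by
    refine intervalIntegral.integral_zero_ae (Eventually.of_forall fun v hv => ?_)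
    rw [Set.uIoc_of_le (NNReal.coe_le_coe.2 (jumpTime_mono ω n.le_succ))] at hv
    refine Set.indicator_of_notMem (fun hmem => hmem.1.not_ge ?_) _
    exact (Real.toNNReal_le_iff_le_coe.2 hv.2).trans hn
  rw [J.stoppedIncrement_succ hA hh hst, compensator_eq_zero,
    Set.indicator_of_notMem fun hmem => hmem.1.not_ge hn, sub_zero, add_zero]

theorem integral_path_stoppedIncrement_sub (hJ : J.HasGenerator r ν A) (hA : IsBoundedRate A l)
    (hh : BoundedBy h C) (hst : s ≤ t) {B : Set (SkorokhodSpace S)}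
    (hB : MeasurableSet[pathFiltration S s] B) (n : ℕ) :
    ∫ ω in J.path ⁻¹' B, (J.stoppedIncrement A h s t (n + 1) ω - J.stoppedIncrement A h s t n ω)
      ∂(noiseLaw r ν) = 0 := by
  classical
  have measurableSet_B := (pathFiltration S).le s B hB
  have increment := (J.boundedBy_stoppedIncrement hA hh hst (n + 1)).sub
    (J.boundedBy_stoppedIncrement hA hh hst n)
  have ae_eq : (J.path ⁻¹' B).indicator (fun ω => J.stoppedIncrement A h s t (n + 1) ω -
        J.stoppedIncrement A h s t n ω) =ᵐ[noiseLaw r ν]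
      ((J.pathUpTo · n) ⁻¹' B).indicator fun ω => J.stoppedIncrement A h s t (n + 1) ω -
        J.stoppedIncrement A h s t n ω := by
    filter_upwards [ae_nonExplosive r ν] with ω hω
    rcases le_or_gt (jumpTime ω (n + 1)) s with hn | hn
    · simp only [Set.indicator_apply, J.stoppedIncrement_succ_of_le hA hh hst hn, sub_self,
        ite_self]
    · simp only [Set.indicator_apply, Set.mem_preimage,
        mem_iff_of_pathEval_eq hB fun _ hu => J.pathEval_path hω (hu.trans_lt hn)]
  rw [← integral_indicator (J.measurable_path measurableSet_B), integral_congr_ae ae_eq, noiseLaw,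
    integral_infinitePi_eq_integral_update _ (n + 1)
      (increment.indicator (J.measurable_pathUpTo n measurableSet_B))]
  refine integral_eq_zero_of_ae (Eventually.of_forall fun ω => ?_)
  simp only [Set.indicator_apply, Set.mem_preimage, J.pathUpTo_update le_rfl]
  split_ifs
  · exact J.integral_stoppedIncrement_update hJ hA hh hst n ω
  · exact integral_zero _ _

theorem integral_path_stoppedIncrement (hJ : J.HasGenerator r ν A) (hA : IsBoundedRate A l)
    (hh : BoundedBy h C) (hst : s ≤ t) {B : Set (SkorokhodSpace S)}
    (hB : MeasurableSet[pathFiltration S s] B) (n : ℕ) :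
    ∫ ω in J.path ⁻¹' B, J.stoppedIncrement A h s t n ω ∂(noiseLaw r ν) = 0 := by
  have integrable (n : ℕ) := (J.boundedBy_stoppedIncrement hA hh hst n).integrable
    ((noiseLaw r ν).restrict (J.path ⁻¹' B))
  induction n with
  | zero => simp only [stoppedIncrement_zero, integral_zero]
  | succ n ih =>
    have increment := J.integral_path_stoppedIncrement_sub hJ hA hh hst hB n
    rwa [integral_sub (integrable (n + 1)) (integrable n), ih, sub_zero] at increment

theorem integral_path_dynkin_sub (hJ : J.HasGenerator r ν A) (hA : IsBoundedRate A l)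
    (hh : BoundedBy h C) (hst : s ≤ t) {B : Set (SkorokhodSpace S)}
    (hB : MeasurableSet[pathFiltration S s] B) :
    ∫ ω in J.path ⁻¹' B, (dynkin A pathEval h t (J.path ω) - dynkin A pathEval h s (J.path ω))
      ∂(noiseLaw r ν) = 0 := by
  have bounded (n : ℕ) := J.boundedBy_stoppedIncrement hA hh hst n
  have tendsto_dynkin : ∀ᵐ ω ∂(noiseLaw r ν).restrict (J.path ⁻¹' B),
      Tendsto (fun n => J.stoppedIncrement A h s t n ω) atTop
        (𝓝 (dynkin A pathEval h t (J.path ω) - dynkin A pathEval h s (J.path ω))) := by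
    filter_upwards [ae_restrict_of_ae (ae_nonExplosive r ν)] with ω hω
    obtain ⟨N, hN⟩ := hω.exists_lt t
    refine tendsto_atTop_of_eventually_const (i₀ := N + 1) fun n hn => ?_
    exact J.stoppedIncrement_eq_dynkin_sub hA hh hst hω (hN.trans_le (jumpTime_mono ω hn))
  refine tendsto_nhds_unique (tendsto_integral_of_dominated_convergence _
    (fun n => (bounded n).measurable.aestronglyMeasurable) (integrable_const _)
    (fun n => Eventually.of_forall (bounded n).abs_le) tendsto_dynkin) ?_
  simp only [J.integral_path_stoppedIncrement hJ hA hh hst hB, tendsto_const_nhds]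

/-- The law of the path of the jump process. -/
def pathLaw (r : ℝ) [Fact (0 < r)] (ν : Measure E) [IsProbabilityMeasure ν] :
    ProbabilityMeasure (SkorokhodSpace S) :=
  ⟨(noiseLaw r ν).map J.path, Measure.isProbabilityMeasure_map J.measurable_path.aemeasurable⟩

theorem martingale_dynkin_pathLaw (hJ : J.HasGenerator r ν A) (hA : IsBoundedRate A l)
    (hh : BoundedBy h C) :
    Martingale (dynkin A pathEval h) (pathFiltration S)
      (J.pathLaw r ν : Measure (SkorokhodSpace S)) := by
  have bounded (u : ℝ≥0) := boundedBy_dynkin hA measurable_uncurry_pathEval hh u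
  have integrable (u : ℝ≥0) := (bounded u).integrable
    (J.pathLaw r ν : Measure (SkorokhodSpace S))
  refine ⟨fun t => (measurable_dynkin_pathEval hA hh t).stronglyMeasurable, fun s t hst =>
    (ae_eq_condExp_of_forall_setIntegral_eq ((pathFiltration S).le s) (integrable t)
      (fun _ _ _ => (integrable s).integrableOn) (fun B hB _ => ?_)
      (measurable_dynkin_pathEval hA hh s).stronglyMeasurable.aestronglyMeasurable).symm⟩
  symm
  rw [← sub_eq_zero, ← integral_sub (integrable t).integrableOn
    (integrable s).integrableOn]
  have change_of_variables := setIntegral_map ((pathFiltration S).le s B hB)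
    ((bounded t).sub (bounded s)).measurable.aestronglyMeasurable
    J.measurable_path.aemeasurable (μ := noiseLaw r ν)
  exact change_of_variables.trans (J.integral_path_dynkin_sub hJ hA hh hst hB)

theorem map_pathEval_zero_pathLaw :
    (J.pathLaw r ν : Measure (SkorokhodSpace S)).map (pathEval 0) = ν.map J.init := by
  have eval (i : ℕ) : MeasurePreserving (fun ω : Noise E => ω i) (noiseLaw r ν)
      ((waitingLaw r).prod ν) :=
    measurePreserving_eval_infinitePi (fun _ : ℕ => (waitingLaw r).prod ν) i
  have ae_pos : ∀ᵐ ω ∂(noiseLaw r ν), 0 < (ω 1).1 :=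
    (measurePreserving_fst.comp (eval 1)).quasiMeasurePreserving.ae (ae_pos_waitingLaw hr.out)
  have mark : MeasurePreserving (fun ω : Noise E => (ω 0).2) (noiseLaw r ν) ν :=
    measurePreserving_snd.comp (eval 0)
  have ae_eq : pathEval 0 ∘ J.path =ᵐ[noiseLaw r ν] J.init ∘ fun ω => (ω 0).2 := by
    filter_upwards [ae_nonExplosive r ν, ae_pos] with ω hω pos
    exact J.pathEval_path hω (n := 0) (by simpa [jumpTime] using pos)
  rw [pathLaw, ProbabilityMeasure.coe_mk, Measure.map_map (measurable_pathEval 0) J.measurable_path,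
    Measure.map_congr ae_eq, ← Measure.map_map J.measurable_init mark.measurable, mark.map_eq]

theorem isMarkovPathLaw_pathLaw [Nonempty S] (hJ : J.HasGenerator r ν A) (hA : IsBoundedRate A l)
    {m₀ : ProbabilityMeasure S} (h₀ : ν.map J.init = m₀) :
    IsMarkovPathLaw A m₀ (J.pathLaw r ν) :=
  .of_martingale hA (J.map_pathEval_zero_pathLaw.trans h₀) fun _ ⟨hm, _, hC⟩ =>
    J.martingale_dynkin_pathLaw hJ hA ⟨hm, hC⟩

end Law

end JumpScheme

theorem CollisionRule.IsSolution.exists_isMarkovPathLaw {S : Type*} [TopologicalSpace S]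
    [MeasurableSpace S] [PolishSpace S] [BorelSpace S] [Nonempty S] {c : CollisionRule S} {r : ℝ≥0}
    (hr : 0 < r) {m₀ : ProbabilityMeasure S} {m : ℝ≥0 → ProbabilityMeasure S}
    (hm : c.IsSolution r m₀ m) :
    ∃ Q : ProbabilityMeasure (SkorokhodSpace S),
      IsMarkovPathLaw (fun t => c.generator r (m t)) m₀ Q := by
  let κ : Kernel ℝ≥0 S := ⟨fun t => (m t : Measure S), hm.measurable⟩
  have : IsMarkovKernel κ := ⟨fun t => (inferInstance : IsProbabilityMeasure (m t : Measure S))⟩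
  have : Fact (0 < (r : ℝ)) := ⟨hr⟩
  obtain ⟨partner, measurable_partner, map_partner⟩ := κ.exists_measurable_map_eq_unitInterval
  have map_partner (t : ℝ≥0) : volume.map (partner t) = (m t : Measure S) := map_partner t
  have measurable_partner_at (t : ℝ≥0) : Measurable (partner t) :=
    measurable_partner.comp measurable_prodMk_left
  let J : JumpScheme S unitInterval :=
    { init := partner 0
      move t z u := c.collide z (partner t u)
      measurable_init := measurable_partner_at 0
      measurable_move := c.measurable_collide.comp (measurable_snd.fst.prodMk
        (measurable_partner.comp (measurable_fst.prodMk measurable_snd.snd))) }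
  have hJ : J.HasGenerator r volume fun t => c.generator r (m t) := fun t h z ⟨hh, _⟩ => by
    simp only [CollisionRule.generator]
    rw [← map_partner t, integral_map (measurable_partner_at t).aemeasurable]
    exact ((hh.comp (c.measurable_collide.comp measurable_prodMk_left)).sub
      measurable_const).aestronglyMeasurable
  exact ⟨J.pathLaw r volume, J.isMarkovPathLaw_pathLaw hJ hm.isBoundedRate
    ((map_partner 0).trans (by rw [hm.1]))⟩

section Encounter

/-- The collision rule of the opinion model: a peer moves towards the opinion of the peer it meets
if the two opinions differ by at most `Δ`. -/
def encounter (w : Opinion) (Δ : ℝ) : CollisionRule Opinion where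
  collide x y := if |(x : ℝ) - y| ≤ Δ then mix w x y else x
  measurable_collide := by
    refine Measurable.ite (measurableSet_le (by fun_prop) measurable_const) ?_ measurable_fst
    unfold mix
    exact Measurable.subtype_mk (by fun_prop)

variable {w : Opinion} {Δ : ℝ}

theorem generator_eq_generator_encounter : generator w Δ = (encounter w Δ).generator 2 := by
  funext μ h x
  simp only [generator, CollisionRule.generator, encounter, Set.indicator_apply, Set.mem_ofPred_eq]
  congr 2 with y
  split_ifs <;> simp

theorem isSolution_iff_encounter {m₀ : ProbabilityMeasure Opinion}
    {m : ℝ≥0 → ProbabilityMeasure Opinion} :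
    IsSolution w Δ m₀ m ↔ (encounter w Δ).IsSolution 2 m₀ m := by
  rw [IsSolution, CollisionRule.IsSolution, generator_eq_generator_encounter]

theorem isMarkovLaw_iff_isMarkovPathLaw {A : ℝ≥0 → (Opinion → ℝ) → Opinion → ℝ}
    {m₀ : ProbabilityMeasure Opinion} {Q : ProbabilityMeasure (SkorokhodSpace Opinion)} :
    IsMarkovLaw A m₀ Q ↔ IsMarkovPathLaw A m₀ Q :=
  ⟨fun h => ⟨h.1, h.2, h.3⟩, fun h => ⟨h.1, h.2, h.3⟩⟩

end Encounter

end Deffuant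

end

open Deffuant in
theorem mainTheorem4_general {S : Type*} [TopologicalSpace S] [MeasurableSpace S] [PolishSpace S]
    [BorelSpace S] (c : CollisionRule S) {r : ℝ≥0} (hr : 0 < r) :
    (∀ m₀ : ProbabilityMeasure S, ∃! m : ℝ≥0 → ProbabilityMeasure S, c.IsSolution r m₀ m) ∧
    (∀ (m₀ : ProbabilityMeasure S) (m : ℝ≥0 → ProbabilityMeasure S), c.IsSolution r m₀ m →
      ∀ t : ℝ≥0, Tendsto (fun s => tvDist (m s) (m t)) (𝓝 t) (𝓝 0)) ∧
    (∀ (m₀ : ProbabilityMeasure S) (m : ℝ≥0 → ProbabilityMeasure S), c.IsSolution r m₀ m →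
      ∀ T : ℝ≥0, ∀ ε : ℝ, 0 < ε → ∃ δ : ℝ, 0 < δ ∧
        ∀ (m₀' : ProbabilityMeasure S) (m' : ℝ≥0 → ProbabilityMeasure S), c.IsSolution r m₀' m' →
          tvDist m₀' m₀ < δ → ∀ t : ℝ≥0, t ≤ T → tvDist (m' t) (m t) < ε) ∧
    (∀ (m₀ : ProbabilityMeasure S) (m : ℝ≥0 → ProbabilityMeasure S), c.IsSolution r m₀ m →
      (∃! Q : ProbabilityMeasure (SkorokhodSpace S),
        IsMarkovPathLaw (fun t => c.generator r (m t)) m₀ Q) ∧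
      ∀ Q : ProbabilityMeasure (SkorokhodSpace S),
        IsMarkovPathLaw (fun t => c.generator r (m t)) m₀ Q →
        ∀ t : ℝ≥0, (Q : Measure (SkorokhodSpace S)).map (pathEval t) = (m t : Measure S)) := by
  refine ⟨fun m₀ => ⟨c.wildSolution m₀ r, c.isSolution_wildSolution m₀,
    fun m hm => hm.unique (c.isSolution_wildSolution m₀)⟩,
    fun m₀ m hm => hm.tendsto_tvDist, fun m₀ m hm T ε => hm.exists_tvDist_lt T,
    fun m₀ m hm => ?_⟩
  have : Nonempty S := nonempty_of_isProbabilityMeasure (m₀ : Measure S)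
  obtain ⟨Q, hQ⟩ := hm.exists_isMarkovPathLaw hr
  exact ⟨⟨Q, hQ, fun Q' hQ' => hQ'.unique hm.isBoundedRate hQ⟩,
    fun Q hQ => hQ.map_pathEval hm.isBoundedRate hm.isLinearFlow hm.1⟩

theorem mainTheorem4 (w : unitInterval) (hw₀ : 0 < w) (hw₁ : w < 1)
    (Δ : ℝ) (hΔ₀ : 0 < Δ) (hΔ₁ : Δ ≤ 1) :
    -- existence and uniqueness for Problem 1
    (∀ m₀ : ProbabilityMeasure Deffuant.Opinion,
      ∃! m : ℝ≥0 → ProbabilityMeasure Deffuant.Opinion, Deffuant.IsSolution w Δ m₀ m) ∧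
    -- continuity in time, in total variation
    (∀ (m₀ : ProbabilityMeasure Deffuant.Opinion)
      (m : ℝ≥0 → ProbabilityMeasure Deffuant.Opinion), Deffuant.IsSolution w Δ m₀ m →
      ∀ t : ℝ≥0, Tendsto (fun s => Deffuant.tvDist (m s) (m t)) (𝓝 t) (𝓝 0)) ∧
    -- continuity in the initial value, in total variation, uniformly on bounded time sets
    (∀ (m₀ : ProbabilityMeasure Deffuant.Opinion)
      (m : ℝ≥0 → ProbabilityMeasure Deffuant.Opinion), Deffuant.IsSolution w Δ m₀ m →
      ∀ T : ℝ≥0, ∀ ε : ℝ, 0 < ε → ∃ δ : ℝ, 0 < δ ∧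
        ∀ (m₀' : ProbabilityMeasure Deffuant.Opinion)
          (m' : ℝ≥0 → ProbabilityMeasure Deffuant.Opinion), Deffuant.IsSolution w Δ m₀' m' →
          Deffuant.tvDist m₀' m₀ < δ → ∀ t : ℝ≥0, t ≤ T → Deffuant.tvDist (m' t) (m t) < ε) ∧
    -- the law of the inhomogeneous Markov process, and its marginals
    (∀ (m₀ : ProbabilityMeasure Deffuant.Opinion)
      (m : ℝ≥0 → ProbabilityMeasure Deffuant.Opinion), Deffuant.IsSolution w Δ m₀ m →
      (∃! Q : ProbabilityMeasure (Deffuant.SkorokhodSpace Deffuant.Opinion),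
        Deffuant.IsMarkovLaw (fun t => Deffuant.generator w Δ (m t)) m₀ Q) ∧
      ∀ Q : ProbabilityMeasure (Deffuant.SkorokhodSpace Deffuant.Opinion),
        Deffuant.IsMarkovLaw (fun t => Deffuant.generator w Δ (m t)) m₀ Q →
        ∀ t : ℝ≥0, (Q : Measure (Deffuant.SkorokhodSpace Deffuant.Opinion)).map
          (Deffuant.coord t) = (m t : Measure Deffuant.Opinion)) := by
  simp only [Deffuant.isSolution_iff_encounter, Deffuant.isMarkovLaw_iff_isMarkovPathLaw,
    Deffuant.generator_eq_generator_encounter]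
  exact mainTheorem4_general (Deffuant.encounter w Δ) two_pos
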